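/- All tensor products of C*-algebras are spatial (minimal). A compact quantum group is a pair $G=(A,\Delta)$ of a unital C*-algebra $A$ and a unital $*$-homomorphism $\Delta:A\to A\otimes A$ such that $(\Delta\otimes\iota)\Delta=(\iota\otimes\Delta)\Delta$ and the sets $(A\otimes I)\Delta(A)$ and $(I\otimes A)\Delta(A)$ span dense subspaces of $A\otimes A$. An action of $G$ on a unital C*-algebra $C$ is a unital $*$-homomorphism $\delta:C\to C\otimes A$ such that $(\delta\otimes\iota)\delta=(\iota\otimes\Delta)\delta$; its fixed point algebra is $C^\delta=\{c\in C:\delta(c)=c\otimes I\}$. A closed left ideal or C*-subalgebra $B$ of $C$ is called $G$-invariant if $\delta(B)\subseteq B\otimes A$, where $B\otimes A$ is the closed linear span in $C\otimes A$ of the elements $b\otimes a$ with $b\in B$, $a\in A$. For subsets $S\subseteq C$, $(I\otimes A)\delta(S)$ denotes the linear span of the elements $(I\otimes a)\delta(s)$ with $a\in A$, $s\in S$. "Proper" means different from $0$ and from the whole algebra (for a projection: different from $0$ and $I$). $C''$ is the enveloping von Neumann algebra (second dual) of $C$, and $\delta'':C''\to(C\otimes A)''$ is the normal extension of $\delta$;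 for $p\in C''$, $p\otimes I\in(C\otimes A)''$ is the image of $p$ under the normal extension of $c\mapsto c\otimes I$. A projection in $C''$ is open if it is the strong limit of a bounded increasing net of positive elements of $C$. **Theorem.** Let $\delta:C\to C\otimes A$ be an action of the compact quantum group $G=(A,\Delta)$ on the unital C*-algebra $C$ such that $(I\otimes A)\delta(C)$ is dense in $C\otimes A$. Then the following properties are equivalent: (a) $C^\delta=\mathbb{C}I$; (b) there is no proper closed $G$-invariant left ideal $\mathcal I$ of $C$ such that $(I\otimes A)\delta(\mathcal I)$ is norm dense in $\mathcal I\otimes A$; (c) there is no proper $G$-invariant hereditary C*-subalgebra $\mathcal H$ of $C$ such that the hereditary C*-subalgebra of $C\otimes A$ generated by $\delta(\mathcal H)$ is $\mathcal H\otimes A$; (d) there is no proper open projection $p\in C''$ such that $\delta''(p)=p\otimes I$. -/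

import Mathlib

-- Spatial tensor products of C*-algebras, compact quantum groups and their actions.

open scoped TensorProduct
open UniformSpace (Completion)

universe u

noncomputable section

namespace QuantumAction

/-- A unital `*`-representation of a unital complex `*`-algebra on a Hilbert space. -/
structure Rep (B : Type u) [Ring B] [StarRing B] [Algebra ℂ B] where
  H : Type u
  [normed : NormedAddCommGroup H]
  [inner : InnerProductSpace ℂ H]
  [complete : CompleteSpace H]
  hom : B →⋆ₐ[ℂ] (H →L[ℂ] H)

attribute [instance] Rep.normed Rep.inner Rep.complete

/-- A family of `*`-representations that is pointwise bounded in norm. -/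
structure RepFamily (B : Type u) [Ring B] [StarRing B] [Algebra ℂ B] where
  ι : Type (u + 1)
  rep : ι → Rep B
  bdd : ∀ b, BddAbove (Set.range fun i => ‖(rep i).hom b‖)

section Family

variable {B : Type u} [Ring B] [StarRing B] [Algebra ℂ B] (F : RepFamily B)

/-- The C*-seminorm `b ↦ sup_i ‖π_i(b)‖` of a family of representations. -/
def RepFamily.sup (b : B) : ℝ := ⨆ i, ‖(F.rep i).hom b‖

theorem RepFamily.le_sup (b : B) (i : F.ι) : ‖(F.rep i).hom b‖ ≤ F.sup b :=
  le_ciSup (F.bdd b) i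

theorem RepFamily.sup_nonneg (b : B) : 0 ≤ F.sup b :=
  Real.iSup_nonneg fun _ => norm_nonneg _

theorem RepFamily.sup_le {b : B} {r : ℝ} (hr : 0 ≤ r) (h : ∀ i, ‖(F.rep i).hom b‖ ≤ r) :
    F.sup b ≤ r := Real.iSup_le h hr

theorem RepFamily.sup_add_le (a b : B) : F.sup (a + b) ≤ F.sup a + F.sup b :=
  F.sup_le (add_nonneg (F.sup_nonneg a) (F.sup_nonneg b)) fun i => by
    rw [map_add]
    exact (norm_add_le _ _).trans (add_le_add (F.le_sup a i) (F.le_sup b i))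

theorem RepFamily.sup_mul_le (a b : B) : F.sup (a * b) ≤ F.sup a * F.sup b :=
  F.sup_le (mul_nonneg (F.sup_nonneg a) (F.sup_nonneg b)) fun i => by
    rw [map_mul]
    exact (norm_mul_le _ _).trans
      (mul_le_mul (F.le_sup a i) (F.le_sup b i) (norm_nonneg _) (F.sup_nonneg a))

theorem RepFamily.sup_smul_le (c : ℂ) (a : B) : F.sup (c • a) ≤ ‖c‖ * F.sup a :=
  F.sup_le (mul_nonneg (norm_nonneg _) (F.sup_nonneg a)) fun i => by
    rw [map_smul, norm_smul]
    exact mul_le_mul_of_nonneg_left (F.le_sup a i) (norm_nonneg _)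

theorem RepFamily.sup_star (a : B) : F.sup (star a) = F.sup a := by
  unfold RepFamily.sup
  simp only [map_star, norm_star]

theorem RepFamily.sup_star_mul_self (a : B) : F.sup a * F.sup a ≤ F.sup (star a * a) := by
  have h : F.sup a ≤ Real.sqrt (F.sup (star a * a)) :=
    F.sup_le (Real.sqrt_nonneg _) fun i => by
      refine Real.le_sqrt_of_sq_le ?_
      have := F.le_sup (star a * a) i
      rwa [map_mul, map_star, CStarRing.norm_star_mul_self, ← sq] at this
  calc F.sup a * F.sup a ≤ Real.sqrt (F.sup (star a * a)) * Real.sqrt (F.sup (star a * a)) :=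
        mul_le_mul h h (F.sup_nonneg a) (Real.sqrt_nonneg _)
    _ = F.sup (star a * a) := Real.mul_self_sqrt (F.sup_nonneg _)

/-- The algebra `B` equipped with the seminorm of the family `F`. -/
@[nolint unusedArguments]
def RepFamily.Pre (_F : RepFamily B) : Type u := B

instance : Ring F.Pre := inferInstanceAs (Ring B)
instance : StarRing F.Pre := inferInstanceAs (StarRing B)
instance : Algebra ℂ F.Pre := inferInstanceAs (Algebra ℂ B)
instance [StarModule ℂ B] : StarModule ℂ F.Pre := inferInstanceAs (StarModule ℂ B)

/-- The identity map from `B` to `B` with the seminorm of `F`. -/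
def RepFamily.toPre : B ≃⋆ₐ[ℂ] F.Pre := StarAlgEquiv.refl (R := ℂ) (A := B)

def RepFamily.ringSeminorm : RingSeminorm F.Pre where
  toFun b := F.sup (F.toPre.symm b)
  map_zero' := le_antisymm (F.sup_le le_rfl fun i => by simp) (F.sup_nonneg _)
  add_le' a b := by rw [map_add]; exact F.sup_add_le _ _
  neg' a := by simp [RepFamily.sup]
  mul_le' a b := by rw [map_mul]; exact F.sup_mul_le _ _

instance : SeminormedRing F.Pre := F.ringSeminorm.toSeminormedRing

theorem RepFamily.norm_toPre (b : B) : ‖F.toPre b‖ = F.sup b := rfl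

instance : NormedAlgebra ℂ F.Pre where
  norm_smul_le c a := F.sup_smul_le c a

theorem RepFamily.norm_star_pre (a : F.Pre) : ‖star a‖ = ‖a‖ := F.sup_star a

def RepFamily.starHom : F.Pre →+ F.Pre := (starAddEquiv : F.Pre ≃+ F.Pre).toAddMonoidHom

theorem RepFamily.uniformContinuous_star : UniformContinuous (star : F.Pre → F.Pre) :=
  uniformContinuous_of_continuousAt_zero F.starHom
    (AddMonoidHomClass.continuous_of_bound F.starHom 1
      fun a => by rw [one_mul]; exact (F.norm_star_pre a).le).continuousAt

/-- The C*-algebra obtained from `B` by separation and completion with respect to the C*-seminorm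
of the family `F`. -/
def RepFamily.Alg : Type u := Completion F.Pre

instance : NormedRing F.Alg := inferInstanceAs (NormedRing (Completion F.Pre))
instance : NormedSpace ℂ F.Alg := inferInstanceAs (NormedSpace ℂ (Completion F.Pre))
instance : Algebra ℂ F.Alg := inferInstanceAs (Algebra ℂ (Completion F.Pre))
instance : NormedAlgebra ℂ F.Alg where
  norm_smul_le c x := norm_smul_le (β := Completion F.Pre) c x
instance : CompleteSpace F.Alg := inferInstanceAs (CompleteSpace (Completion F.Pre))

def RepFamily.coe (b : B) : F.Alg := ((F.toPre b : F.Pre) : Completion F.Pre)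

theorem RepFamily.norm_coe (b : B) : ‖F.coe b‖ = F.sup b := Completion.norm_coe _

theorem RepFamily.denseRange_coe : DenseRange F.coe :=
  Completion.denseRange_coe.comp F.toPre.surjective.denseRange
    (Completion.continuous_coe _)

theorem RepFamily.induction {p : F.Alg → Prop} (hp : IsClosed {x | p x})
    (h : ∀ b, p (F.coe b)) (x : F.Alg) : p x :=
  F.denseRange_coe.induction_on x hp h

instance : Star F.Alg := ⟨Completion.map (star : F.Pre → F.Pre)⟩

theorem RepFamily.continuous_star : Continuous (star : F.Alg → F.Alg) := Completion.continuous_map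

theorem RepFamily.star_coe (b : B) : star (F.coe b) = F.coe (star b) :=
  Completion.map_coe F.uniformContinuous_star _

theorem RepFamily.coe_add (a b : B) : F.coe (a + b) = F.coe a + F.coe b := Completion.coe_add _ _
theorem RepFamily.coe_mul (a b : B) : F.coe (a * b) = F.coe a * F.coe b := Completion.coe_mul _ _
theorem RepFamily.coe_one : F.coe 1 = 1 := rfl
theorem RepFamily.coe_zero : F.coe 0 = 0 := rfl
theorem RepFamily.coe_smul (c : ℂ) (b : B) : F.coe (c • b) = c • F.coe b :=
  Completion.coe_smul (X := F.Pre) c (F.toPre b)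

theorem RepFamily.induction₂ {p : F.Alg → F.Alg → Prop}
    (hp : IsClosed {x : F.Alg × F.Alg | p x.1 x.2})
    (h : ∀ a b, p (F.coe a) (F.coe b)) (x y : F.Alg) : p x y :=
  F.denseRange_coe.induction_on₂ hp h x y

instance : StarRing F.Alg where
  star_involutive x := by
    refine F.induction (p := fun x => star (star x) = x) (isClosed_eq
      (F.continuous_star.comp F.continuous_star) continuous_id) (fun b => ?_) x
    rw [F.star_coe, F.star_coe, star_star]
  star_mul x y := by
    refine F.induction₂ (p := fun x y => star (x * y) = star y * star x) (isClosed_eq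
      (F.continuous_star.comp (continuous_fst.mul continuous_snd))
      ((F.continuous_star.comp continuous_snd).mul (F.continuous_star.comp continuous_fst)))
      (fun a b => ?_) x y
    rw [← F.coe_mul, F.star_coe, F.star_coe, F.star_coe, star_mul, F.coe_mul]
  star_add x y := by
    refine F.induction₂ (p := fun x y => star (x + y) = star x + star y) (isClosed_eq
      (F.continuous_star.comp (continuous_fst.add continuous_snd))
      ((F.continuous_star.comp continuous_fst).add (F.continuous_star.comp continuous_snd)))
      (fun a b => ?_) x y
    rw [← F.coe_add, F.star_coe, F.star_coe, F.star_coe, star_add, F.coe_add]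

instance : CStarRing F.Alg where
  norm_mul_self_le x := by
    refine F.induction (p := fun x => ‖x‖ * ‖x‖ ≤ ‖star x * x‖) (isClosed_le
      (continuous_norm.mul continuous_norm)
      (continuous_norm.comp (F.continuous_star.mul continuous_id))) (fun b => ?_) x
    rw [F.star_coe, ← F.coe_mul, F.norm_coe, F.norm_coe]
    exact F.sup_star_mul_self b

instance [StarModule ℂ B] : StarModule ℂ F.Alg where
  star_smul c x := by
    refine F.induction (p := fun x => star (c • x) = star c • star x) (isClosed_eq
      (F.continuous_star.comp (continuous_const_smul c))
      (continuous_const_smul (star c) |>.comp F.continuous_star)) (fun b => ?_) x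
    rw [← F.coe_smul, F.star_coe, F.star_coe, star_smul, F.coe_smul]

instance [StarModule ℂ B] : CStarAlgebra F.Alg where

/-- The canonical `*`-homomorphism from `B` to its completion. -/
def RepFamily.of : B →⋆ₐ[ℂ] F.Alg where
  toFun := F.coe
  map_one' := F.coe_one
  map_mul' := F.coe_mul
  map_zero' := F.coe_zero
  map_add' := F.coe_add
  commutes' c := by
    rw [Algebra.algebraMap_eq_smul_one, F.coe_smul, F.coe_one, Algebra.algebraMap_eq_smul_one]
  map_star' b := (F.star_coe b).symm

theorem RepFamily.norm_of (b : B) : ‖F.of b‖ = F.sup b := F.norm_coe b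

theorem RepFamily.denseRange_of : DenseRange F.of := F.denseRange_coe

variable {D : Type u} [CStarAlgebra D]

def RepFamily.preHom (f : B →⋆ₐ[ℂ] D) : F.Pre →⋆ₐ[ℂ] D where
  toFun b := f (F.toPre.symm b)
  map_one' := map_one f
  map_mul' := map_mul f
  map_zero' := map_zero f
  map_add' := map_add f
  commutes' c := AlgHomClass.commutes f c
  map_star' b := map_star f b

theorem RepFamily.continuous_preHom (f : B →⋆ₐ[ℂ] D) (hf : ∀ b, ‖f b‖ ≤ F.sup b) :
    Continuous (F.preHom f : F.Pre →+* D) :=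
  AddMonoidHomClass.continuous_of_bound (F.preHom f : F.Pre →+* D) 1
    fun b => by rw [one_mul]; exact hf (F.toPre.symm b)

/-- The continuous extension to the completion of a `*`-homomorphism that is bounded by the
seminorm. -/
def RepFamily.extend (f : B →⋆ₐ[ℂ] D) (hf : ∀ b, ‖f b‖ ≤ F.sup b) : F.Alg →⋆ₐ[ℂ] D :=
  have hcoe : ∀ b, Completion.extensionHom (F.preHom f : F.Pre →+* D) (F.continuous_preHom f hf)
      (F.coe b) = f b := fun b =>
    Completion.extensionHom_coe (F.preHom f : F.Pre →+* D) (F.continuous_preHom f hf) (F.toPre b)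
  have hcont : Continuous (fun x : F.Alg =>
      Completion.extensionHom (F.preHom f : F.Pre →+* D) (F.continuous_preHom f hf) x) :=
    Completion.continuous_extension
  { toFun x := Completion.extensionHom (F.preHom f : F.Pre →+* D) (F.continuous_preHom f hf) x
    map_one' := map_one (Completion.extensionHom (F.preHom f : F.Pre →+* D) _)
    map_mul' := map_mul (Completion.extensionHom (F.preHom f : F.Pre →+* D) _)
    map_zero' := map_zero (Completion.extensionHom (F.preHom f : F.Pre →+* D) _)
    map_add' := map_add (Completion.extensionHom (F.preHom f : F.Pre →+* D) _)
    commutes' c := by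
      rw [Algebra.algebraMap_eq_smul_one, ← F.coe_one, ← F.coe_smul, hcoe, map_smul, map_one,
        Algebra.algebraMap_eq_smul_one]
    map_star' x := by
      refine F.induction (p := fun x : F.Alg => Completion.extensionHom
        (F.preHom f : F.Pre →+* D) (F.continuous_preHom f hf) (star x : F.Alg) = star (Completion.extensionHom
          (F.preHom f : F.Pre →+* D) (F.continuous_preHom f hf) x))
        (isClosed_eq (hcont.comp F.continuous_star) (hcont.star)) (fun b => ?_) x
      rw [F.star_coe, hcoe, hcoe, map_star] }

theorem RepFamily.extend_of (f : B →⋆ₐ[ℂ] D) (hf : ∀ b, ‖f b‖ ≤ F.sup b) (b : B) :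
    F.extend f hf (F.of b) = f b :=
  Completion.extensionHom_coe (F.preHom f : F.Pre →+* D) (F.continuous_preHom f hf) (F.toPre b)

/-- Each member of the family extends to a representation of the completion. -/
def RepFamily.extRep [StarModule ℂ B] (i : F.ι) : Rep F.Alg where
  H := (F.rep i).H
  hom := F.extend (F.rep i).hom fun b => F.le_sup b i

/-- The norm of the completion is the supremum of the norms in the extended representations. -/
theorem RepFamily.norm_le_of_extRep [StarModule ℂ B] (x : F.Alg) {r : ℝ} (hr : 0 ≤ r)
    (h : ∀ i, ‖(F.extRep i).hom x‖ ≤ r) : ‖x‖ ≤ r := by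
  refine le_of_forall_pos_le_add fun ε hε => ?_
  obtain ⟨b, hb⟩ := F.denseRange_of.exists_dist_lt x (half_pos hε)
  rw [dist_eq_norm] at hb
  have h1 : ‖F.of b‖ ≤ r + ε / 2 := by
    rw [F.norm_of]
    refine F.sup_le (by positivity) fun i => ?_
    have e : (F.rep i).hom b = (F.extRep i).hom x - (F.extRep i).hom (x - F.of b) := by
      rw [map_sub, sub_sub_cancel]
      exact (F.extend_of (F.rep i).hom (fun b => F.le_sup b i) b).symm
    rw [e]
    refine (norm_sub_le _ _).trans (add_le_add (h i) ?_)
    exact (NonUnitalStarAlgHom.norm_apply_le (F.extRep i).hom (x - F.of b)).trans hb.le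
  calc ‖x‖ = ‖(x - F.of b) + F.of b‖ := by rw [sub_add_cancel]
    _ ≤ ‖x - F.of b‖ + ‖F.of b‖ := norm_add_le _ _
    _ ≤ r + ε := by linarith

end Family

section HilbertTensor

variable (H K L : Type u)
  [NormedAddCommGroup H] [InnerProductSpace ℂ H]
  [NormedAddCommGroup K] [InnerProductSpace ℂ K]
  [NormedAddCommGroup L] [InnerProductSpace ℂ L]

/-- The Hilbert space tensor product: the completion of the algebraic tensor product. -/
def HTensor : Type u := Completion (H ⊗[ℂ] K)

instance : NormedAddCommGroup (HTensor H K) :=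
  inferInstanceAs (NormedAddCommGroup (Completion (H ⊗[ℂ] K)))
instance : InnerProductSpace ℂ (HTensor H K) :=
  inferInstanceAs (InnerProductSpace ℂ (Completion (H ⊗[ℂ] K)))
instance : CompleteSpace (HTensor H K) := inferInstanceAs (CompleteSpace (Completion (H ⊗[ℂ] K)))

/-- The isometric embedding of the algebraic into the Hilbert space tensor product. -/
def htOf : (H ⊗[ℂ] K) →ₗᵢ[ℂ] HTensor H K := Completion.toComplₗᵢ

theorem denseRange_htOf : DenseRange (htOf H K) := Completion.denseRange_coe

variable {H K L}

theorem htensor_ext {S T : HTensor H K →L[ℂ] HTensor H K}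
    (h : ∀ x, S (htOf H K x) = T (htOf H K x)) : S = T := by
  ext x
  exact (denseRange_htOf H K).induction_on (p := fun x => S x = T x) x
    (isClosed_eq S.continuous T.continuous) h

theorem inner_mapL [CompleteSpace H] [CompleteSpace K] (S : H →L[ℂ] H) (T : K →L[ℂ] K)
    (x y : H ⊗[ℂ] K) :
    inner ℂ (TensorProduct.mapL (star S) (star T) x) y = inner ℂ x (TensorProduct.mapL S T y) := by
  induction x with
  | zero => simp
  | add x₁ x₂ h₁ h₂ => rw [map_add, inner_add_left, inner_add_left, h₁, h₂]
  | tmul a b =>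
    induction y with
    | zero => simp
    | add y₁ y₂ h₁ h₂ => rw [map_add, inner_add_right, inner_add_right, h₁, h₂]
    | tmul c d =>
      simp [ContinuousLinearMap.star_eq_adjoint, ContinuousLinearMap.adjoint_inner_left]

/-- The operator `S ⊗ T` on the Hilbert space tensor product. -/
def opTensor (S : H →L[ℂ] H) (T : K →L[ℂ] K) : HTensor H K →L[ℂ] HTensor H K :=
  (TensorProduct.mapL S T).completion

theorem opTensor_htOf (S : H →L[ℂ] H) (T : K →L[ℂ] K) (x : H ⊗[ℂ] K) :
    opTensor S T (htOf H K x) = htOf H K (TensorProduct.mapL S T x) :=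
  ContinuousLinearMap.completion_apply_coe _ _

theorem opTensor_mul (S S' : H →L[ℂ] H) (T T' : K →L[ℂ] K) :
    opTensor (S * S') (T * T') = opTensor S T * opTensor S' T' :=
  htensor_ext fun x => by
    change _ = opTensor S T (opTensor S' T' (htOf H K x))
    rw [opTensor_htOf, opTensor_htOf, opTensor_htOf, TensorProduct.mapL_mul]
    rfl

theorem opTensor_one : opTensor (1 : H →L[ℂ] H) (1 : K →L[ℂ] K) = 1 :=
  htensor_ext fun x => by
    rw [opTensor_htOf]
    exact congrArg (htOf H K) (congrArg (fun f : (H ⊗[ℂ] K) →L[ℂ] (H ⊗[ℂ] K) => f x)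
      (TensorProduct.mapL_id_id))

theorem opTensor_star [CompleteSpace H] [CompleteSpace K] (S : H →L[ℂ] H) (T : K →L[ℂ] K) :
    opTensor (star S) (star T) = star (opTensor S T) := by
  refine (ContinuousLinearMap.eq_adjoint_iff _ _).mpr fun x y => ?_
  refine (denseRange_htOf H K).induction_on₂ (p := fun x y =>
    inner ℂ (opTensor (star S) (star T) x) y = inner ℂ x (opTensor S T y))
    (isClosed_eq (by fun_prop) (by fun_prop)) (fun a b => ?_) x y
  rw [opTensor_htOf, opTensor_htOf, LinearIsometry.inner_map_map, LinearIsometry.inner_map_map,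
    inner_mapL]

theorem opTensor_add_left (S S' : H →L[ℂ] H) (T : K →L[ℂ] K) :
    opTensor (S + S') T = opTensor S T + opTensor S' T :=
  htensor_ext fun x => by
    rw [_root_.add_apply, opTensor_htOf, opTensor_htOf, opTensor_htOf,
      TensorProduct.mapL_add_left, _root_.add_apply, map_add]

theorem opTensor_add_right (S : H →L[ℂ] H) (T T' : K →L[ℂ] K) :
    opTensor S (T + T') = opTensor S T + opTensor S T' :=
  htensor_ext fun x => by
    rw [_root_.add_apply, opTensor_htOf, opTensor_htOf, opTensor_htOf,
      TensorProduct.mapL_add_right, _root_.add_apply, map_add]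

theorem opTensor_smul_left (c : ℂ) (S : H →L[ℂ] H) (T : K →L[ℂ] K) :
    opTensor (c • S) T = c • opTensor S T :=
  htensor_ext fun x => by
    rw [_root_.smul_apply, opTensor_htOf, opTensor_htOf,
      TensorProduct.mapL_smul_left, _root_.smul_apply, map_smul]

theorem opTensor_smul_right (c : ℂ) (S : H →L[ℂ] H) (T : K →L[ℂ] K) :
    opTensor S (c • T) = c • opTensor S T :=
  htensor_ext fun x => by
    rw [_root_.smul_apply, opTensor_htOf, opTensor_htOf,
      TensorProduct.mapL_smul_right, _root_.smul_apply, map_smul]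

theorem opTensor_norm_le (S : H →L[ℂ] H) (T : K →L[ℂ] K) : ‖opTensor S T‖ ≤ ‖S‖ * ‖T‖ := by
  refine ContinuousLinearMap.opNorm_le_bound _ (by positivity) fun x => ?_
  refine (denseRange_htOf H K).induction_on (p := fun x =>
    ‖opTensor S T x‖ ≤ ‖S‖ * ‖T‖ * ‖x‖) x (isClosed_le (by fun_prop) (by fun_prop)) fun x => ?_
  rw [opTensor_htOf, LinearIsometry.norm_map, LinearIsometry.norm_map]
  exact (ContinuousLinearMap.le_opNorm _ _).trans
    (mul_le_mul_of_nonneg_right (TensorProduct.norm_mapL_le S T) (norm_nonneg _))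

/-- `S ↦ S ⊗ 1`. -/
def ampLeft (H K : Type u) [NormedAddCommGroup H] [InnerProductSpace ℂ H] [CompleteSpace H]
    [NormedAddCommGroup K] [InnerProductSpace ℂ K] [CompleteSpace K] :
    (H →L[ℂ] H) →⋆ₐ[ℂ] (HTensor H K →L[ℂ] HTensor H K) where
  toFun S := opTensor S 1
  map_one' := opTensor_one
  map_mul' S T := by rw [← opTensor_mul, one_mul]
  map_zero' := by simpa using opTensor_smul_left 0 (0 : H →L[ℂ] H) (1 : K →L[ℂ] K)
  map_add' S T := opTensor_add_left S T 1
  commutes' c := by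
    rw [Algebra.algebraMap_eq_smul_one, Algebra.algebraMap_eq_smul_one, opTensor_smul_left,
      opTensor_one]
  map_star' S := by rw [← opTensor_star, star_one]

/-- `T ↦ 1 ⊗ T`. -/
def ampRight (H K : Type u) [NormedAddCommGroup H] [InnerProductSpace ℂ H] [CompleteSpace H]
    [NormedAddCommGroup K] [InnerProductSpace ℂ K] [CompleteSpace K] :
    (K →L[ℂ] K) →⋆ₐ[ℂ] (HTensor H K →L[ℂ] HTensor H K) where
  toFun T := opTensor 1 T
  map_one' := opTensor_one
  map_mul' S T := by rw [← opTensor_mul, one_mul]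
  map_zero' := by simpa using opTensor_smul_right 0 (1 : H →L[ℂ] H) (0 : K →L[ℂ] K)
  map_add' S T := opTensor_add_right 1 S T
  commutes' c := by
    rw [Algebra.algebraMap_eq_smul_one, Algebra.algebraMap_eq_smul_one, opTensor_smul_right,
      opTensor_one]
  map_star' S := by rw [← opTensor_star, star_one]

end HilbertTensor

/-- Two commuting `*`-homomorphisms `f`, `g` give the `*`-homomorphism `a ⊗ b ↦ f(a) g(b)` on the
algebraic tensor product. -/
def liftStar {A B D : Type u} [Ring A] [StarRing A] [Algebra ℂ A] [StarModule ℂ A]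
    [Ring B] [StarRing B] [Algebra ℂ B] [StarModule ℂ B]
    [Ring D] [StarRing D] [Algebra ℂ D]
    (f : A →⋆ₐ[ℂ] D) (g : B →⋆ₐ[ℂ] D) (h : ∀ a b, Commute (f a) (g b)) :
    (A ⊗[ℂ] B) →⋆ₐ[ℂ] D :=
  { Algebra.TensorProduct.lift (f : A →ₐ[ℂ] D) (g : B →ₐ[ℂ] D) h with
    map_star' x := by
      change Algebra.TensorProduct.lift (f : A →ₐ[ℂ] D) (g : B →ₐ[ℂ] D) h (star x) =
        star (Algebra.TensorProduct.lift (f : A →ₐ[ℂ] D) (g : B →ₐ[ℂ] D) h x)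
      induction x with
      | zero => simp
      | add x y hx hy => rw [star_add, map_add, map_add, star_add, hx, hy]
      | tmul a b =>
        rw [TensorProduct.star_tmul, Algebra.TensorProduct.lift_tmul,
          Algebra.TensorProduct.lift_tmul, star_mul]
        simp only [StarAlgHom.coe_toAlgHom, map_star]
        have := h (star a) (star b)
        rw [map_star, map_star] at this
        exact this }

theorem liftStar_tmul {A B D : Type u} [Ring A] [StarRing A] [Algebra ℂ A] [StarModule ℂ A]
    [Ring B] [StarRing B] [Algebra ℂ B] [StarModule ℂ B]
    [Ring D] [StarRing D] [Algebra ℂ D]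
    (f : A →⋆ₐ[ℂ] D) (g : B →⋆ₐ[ℂ] D) (h : ∀ a b, Commute (f a) (g b)) (a : A) (b : B) :
    liftStar f g h (a ⊗ₜ b) = f a * g b :=
  Algebra.TensorProduct.lift_tmul (f : A →ₐ[ℂ] D) (g : B →ₐ[ℂ] D) h a b

section ProductRep

variable {A B : Type u} [Ring A] [StarRing A] [Algebra ℂ A] [StarModule ℂ A]
  [Ring B] [StarRing B] [Algebra ℂ B] [StarModule ℂ B]
  {H K : Type u} [NormedAddCommGroup H] [InnerProductSpace ℂ H] [CompleteSpace H]
  [NormedAddCommGroup K] [InnerProductSpace ℂ K] [CompleteSpace K]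

/-- The tensor product `π ⊗ ρ` of two representations, acting on the Hilbert space tensor
product. -/
def prodHom (π : A →⋆ₐ[ℂ] (H →L[ℂ] H)) (ρ : B →⋆ₐ[ℂ] (K →L[ℂ] K)) :
    (A ⊗[ℂ] B) →⋆ₐ[ℂ] (HTensor H K →L[ℂ] HTensor H K) :=
  liftStar (D := HTensor H K →L[ℂ] HTensor H K) ((ampLeft H K).comp π) ((ampRight H K).comp ρ) fun a b => by
    change opTensor _ _ * opTensor _ _ = opTensor _ _ * opTensor _ _
    rw [← opTensor_mul, ← opTensor_mul, one_mul, one_mul, mul_one, mul_one]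

theorem prodHom_tmul (π : A →⋆ₐ[ℂ] (H →L[ℂ] H)) (ρ : B →⋆ₐ[ℂ] (K →L[ℂ] K)) (a : A) (b : B) :
    prodHom π ρ (a ⊗ₜ b) = opTensor (π a) (ρ b) := by
  have key : opTensor (π a) (1 : K →L[ℂ] K) * opTensor (1 : H →L[ℂ] H) (ρ b) =
      opTensor (π a) (ρ b) := by rw [← opTensor_mul, one_mul, mul_one]
  exact (liftStar_tmul (D := HTensor H K →L[ℂ] HTensor H K) ((ampLeft H K).comp π)
    ((ampRight H K).comp ρ) _ a b).trans key

/-- The bundled form of `prodHom`. -/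
def Rep.prod (π : Rep A) (ρ : Rep B) : Rep (A ⊗[ℂ] B) where
  H := HTensor π.H ρ.H
  hom := prodHom π.hom ρ.hom

end ProductRep

section Associator

variable {E F L : Type u} [NormedAddCommGroup E] [InnerProductSpace ℂ E]
  [NormedAddCommGroup F] [InnerProductSpace ℂ F] [NormedAddCommGroup L] [InnerProductSpace ℂ L]

theorem denseRange_of_tmul {V : Type u} [NormedAddCommGroup V] [NormedSpace ℂ V]
    (f : V →L[ℂ] (E ⊗[ℂ] F)) (h : ∀ x y, x ⊗ₜ[ℂ] y ∈ closure (Set.range f)) : DenseRange f := by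
  intro z
  have hm : closure (Set.range f) = ((LinearMap.range f.toLinearMap).topologicalClosure : Set _) := by
    rw [Submodule.topologicalClosure_coe]; rfl
  rw [hm] at h ⊢
  induction z with
  | zero => exact Submodule.zero_mem _
  | add a b ha hb => exact Submodule.add_mem _ ha hb
  | tmul x y => exact h x y

theorem denseRange_rTensor {f : E →ₗᵢ[ℂ] F} (hf : DenseRange f) :
    DenseRange (f.rTensor L) := by
  refine denseRange_of_tmul (f.rTensor L).toContinuousLinearMap fun x y => ?_
  refine hf.induction_on (p := fun x => x ⊗ₜ[ℂ] y ∈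
    closure (Set.range (f.rTensor L))) x ?_ fun e => ?_
  · exact isClosed_closure.preimage
      (TensorProduct.continuous_tmul.comp (continuous_id.prodMk continuous_const))
  · exact subset_closure ⟨e ⊗ₜ y, rfl⟩

theorem denseRange_lTensor {f : E →ₗᵢ[ℂ] F} (hf : DenseRange f) :
    DenseRange (f.lTensor L) := by
  refine denseRange_of_tmul (f.lTensor L).toContinuousLinearMap fun y x => ?_
  refine hf.induction_on (p := fun x => y ⊗ₜ[ℂ] x ∈
    closure (Set.range (f.lTensor L))) x ?_ fun e => ?_
  · exact isClosed_closure.preimage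
      (TensorProduct.continuous_tmul.comp (continuous_const.prodMk continuous_id))
  · exact subset_closure ⟨y ⊗ₜ e, rfl⟩

variable (H K L : Type u)
  [NormedAddCommGroup H] [InnerProductSpace ℂ H]
  [NormedAddCommGroup K] [InnerProductSpace ℂ K]
  [NormedAddCommGroup L] [InnerProductSpace ℂ L]

/-- The isometric embedding of the algebraic triple tensor product, bracketed to the left. -/
def tripleLeft : ((H ⊗[ℂ] K) ⊗[ℂ] L) →ₗᵢ[ℂ] HTensor (HTensor H K) L :=
  (htOf (HTensor H K) L).comp ((htOf H K).rTensor L)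

/-- The isometric embedding of the algebraic triple tensor product, bracketed to the right. -/
def tripleRight : (H ⊗[ℂ] (K ⊗[ℂ] L)) →ₗᵢ[ℂ] HTensor H (HTensor K L) :=
  (htOf H (HTensor K L)).comp ((htOf K L).lTensor H)

theorem tripleLeft_dense : DenseRange (tripleLeft H K L) :=
  (denseRange_htOf (HTensor H K) L).comp (denseRange_rTensor (denseRange_htOf H K))
    (htOf (HTensor H K) L).continuous

theorem tripleRight_dense : DenseRange (tripleRight H K L) :=
  (denseRange_htOf H (HTensor K L)).comp (denseRange_lTensor (denseRange_htOf K L))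
    (htOf H (HTensor K L)).continuous

/-- The associator of the Hilbert space tensor product. -/
def hassoc : HTensor (HTensor H K) L ≃ₗᵢ[ℂ] HTensor H (HTensor K L) :=
  (TensorProduct.assoc ℂ H K L).extendOfIsometry (tripleLeft H K L).toLinearMap
    (tripleRight H K L).toLinearMap (tripleLeft_dense H K L) (tripleRight_dense H K L)
    fun x => by
      change ‖tripleRight H K L _‖ = ‖tripleLeft H K L x‖
      rw [LinearIsometry.norm_map, LinearIsometry.norm_map, TensorProduct.norm_assoc]

theorem hassoc_tripleLeft (x : (H ⊗[ℂ] K) ⊗[ℂ] L) :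
    hassoc H K L (tripleLeft H K L x) = tripleRight H K L (TensorProduct.assoc ℂ H K L x) :=
  LinearEquiv.extendOfIsometry_eq _ _ _ _ _ _ _

variable {H K L}

theorem hassoc_opTensor (R : H →L[ℂ] H) (S : K →L[ℂ] K) (T : L →L[ℂ] L)
    (x : HTensor (HTensor H K) L) :
    hassoc H K L (opTensor (opTensor R S) T x) =
      opTensor R (opTensor S T) (hassoc H K L x) := by
  refine (tripleLeft_dense H K L).induction_on x
    (isClosed_eq (by fun_prop) (by fun_prop)) fun v => ?_
  rw [hassoc_tripleLeft]
  induction v with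
  | zero => simp only [map_zero, LinearIsometry.map_zero]
  | add v w hv hw => simp only [map_add, hv, hw]
  | tmul y l =>
    induction y with
    | zero => simp only [TensorProduct.zero_tmul, map_zero, LinearIsometry.map_zero]
    | add y z hy hz => simp only [TensorProduct.add_tmul, map_add, hy, hz]
    | tmul h k =>
      have e1 : opTensor (opTensor R S) T (tripleLeft H K L ((h ⊗ₜ k) ⊗ₜ l)) =
          tripleLeft H K L ((R h ⊗ₜ S k) ⊗ₜ T l) := by
        change opTensor (opTensor R S) T (htOf (HTensor H K) L (htOf H K (h ⊗ₜ k) ⊗ₜ l)) = _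
        rw [opTensor_htOf, TensorProduct.mapL_tmul, opTensor_htOf, TensorProduct.mapL_tmul]
        rfl
      have e2 : opTensor R (opTensor S T) (tripleRight H K L (h ⊗ₜ (k ⊗ₜ l))) =
          tripleRight H K L (R h ⊗ₜ (S k ⊗ₜ T l)) := by
        change opTensor R (opTensor S T) (htOf H (HTensor K L) (h ⊗ₜ htOf K L (k ⊗ₜ l))) = _
        rw [opTensor_htOf, TensorProduct.mapL_tmul, opTensor_htOf, TensorProduct.mapL_tmul]
        rfl
      rw [e1, hassoc_tripleLeft, TensorProduct.assoc_tmul, TensorProduct.assoc_tmul, e2]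

end Associator

section Families

/-- The family of all representations of a unital C*-algebra. -/
def allReps (A : Type u) [CStarAlgebra A] : RepFamily A where
  ι := Rep A
  rep π := π
  bdd a := ⟨‖a‖, by rintro _ ⟨π, rfl⟩; exact NonUnitalStarAlgHom.norm_apply_le π.hom a⟩

variable {A B : Type u} [Ring A] [StarRing A] [Algebra ℂ A] [StarModule ℂ A]
  [Ring B] [StarRing B] [Algebra ℂ B] [StarModule ℂ B]

/-- The family of all products `π ⊗ ρ` with `π` in the first and `ρ` in the second family. -/
def RepFamily.prod (F : RepFamily A) (G : RepFamily B) : RepFamily (A ⊗[ℂ] B) where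
  ι := F.ι × G.ι
  rep i := (F.rep i.1).prod (G.rep i.2)
  bdd x := by
    induction x with
    | zero => exact ⟨0, by rintro _ ⟨i, rfl⟩; simp⟩
    | add x y hx hy =>
      obtain ⟨r, hr⟩ := hx
      obtain ⟨s, hs⟩ := hy
      refine ⟨r + s, ?_⟩
      rintro _ ⟨i, rfl⟩
      simp only [map_add]
      exact (norm_add_le _ _).trans (add_le_add (hr ⟨i, rfl⟩) (hs ⟨i, rfl⟩))
    | tmul a b =>
      refine ⟨F.sup a * G.sup b, ?_⟩
      rintro _ ⟨i, rfl⟩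
      refine (congrArg norm (prodHom_tmul (F.rep i.1).hom (G.rep i.2).hom a b)).trans_le ?_
      exact (opTensor_norm_le _ _).trans
        (mul_le_mul (F.le_sup a _) (G.le_sup b _) (norm_nonneg _) (F.sup_nonneg a))

end Families

/-- The spatial (minimal) tensor product of two unital C*-algebras: the completion of the algebraic
tensor product in the norm `‖t‖ = sup ‖(π ⊗ ρ)(t)‖` over all representations `π`, `ρ`. -/
abbrev Spatial (A B : Type u) [CStarAlgebra A] [CStarAlgebra B] : Type u :=
  ((allReps A).prod (allReps B)).Alg

/-- The spatial tensor product of three unital C*-algebras: the completion of the algebraic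
tensor product in the norm `‖t‖ = sup ‖(π ⊗ ρ ⊗ σ)(t)‖` over all representations
`π`, `ρ`, `σ`. -/
abbrev Spatial₃ (A B C : Type u) [CStarAlgebra A] [CStarAlgebra B] [CStarAlgebra C] : Type u :=
  (((allReps A).prod (allReps B)).prod (allReps C)).Alg

section Maps

variable (A B C : Type u) [CStarAlgebra A] [CStarAlgebra B] [CStarAlgebra C]

/-- `x ↦ x ⊗ 1` into the algebraic tensor product. -/
def algLeft (A B : Type u) [Ring A] [StarRing A] [Algebra ℂ A] [StarModule ℂ A]
    [Ring B] [StarRing B] [Algebra ℂ B] [StarModule ℂ B] : A →⋆ₐ[ℂ] (A ⊗[ℂ] B) :=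
  { (Algebra.TensorProduct.includeLeft : A →ₐ[ℂ] A ⊗[ℂ] B) with
    map_star' a := by
      change star a ⊗ₜ[ℂ] (1 : B) = star (a ⊗ₜ[ℂ] (1 : B))
      rw [TensorProduct.star_tmul, star_one] }

/-- `x ↦ 1 ⊗ x` into the algebraic tensor product. -/
def algRight (A B : Type u) [Ring A] [StarRing A] [Algebra ℂ A] [StarModule ℂ A]
    [Ring B] [StarRing B] [Algebra ℂ B] [StarModule ℂ B] : B →⋆ₐ[ℂ] (A ⊗[ℂ] B) :=
  { (Algebra.TensorProduct.includeRight : B →ₐ[ℂ] A ⊗[ℂ] B) with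
    map_star' a := by
      change (1 : A) ⊗ₜ[ℂ] star a = star ((1 : A) ⊗ₜ[ℂ] a)
      rw [TensorProduct.star_tmul, star_one] }

/-- The canonical map of the algebraic into the spatial tensor product. -/
def spatialOf : (A ⊗[ℂ] B) →⋆ₐ[ℂ] Spatial A B := ((allReps A).prod (allReps B)).of

/-- `a ↦ a ⊗ 1`. -/
def spatialLeft : A →⋆ₐ[ℂ] Spatial A B := (spatialOf A B).comp (algLeft A B)

/-- `b ↦ 1 ⊗ b`. -/
def spatialRight : B →⋆ₐ[ℂ] Spatial A B := (spatialOf A B).comp (algRight A B)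

/-- The canonical map of the algebraic into the spatial triple tensor product. -/
def spatialOf₃ : ((A ⊗[ℂ] B) ⊗[ℂ] C) →⋆ₐ[ℂ] Spatial₃ A B C :=
  (((allReps A).prod (allReps B)).prod (allReps C)).of

variable {A B C}

/-- The elementary tensor `a ⊗ b` in the spatial tensor product. -/
def tens (a : A) (b : B) : Spatial A B := spatialOf A B (a ⊗ₜ b)

variable {H K L : Type u} [NormedAddCommGroup H] [InnerProductSpace ℂ H] [CompleteSpace H]
  [NormedAddCommGroup K] [InnerProductSpace ℂ K] [CompleteSpace K]
  [NormedAddCommGroup L] [InnerProductSpace ℂ L] [CompleteSpace L]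
  (π : A →⋆ₐ[ℂ] (H →L[ℂ] H)) (ρ : B →⋆ₐ[ℂ] (K →L[ℂ] K)) (σ : C →⋆ₐ[ℂ] (L →L[ℂ] L))

theorem norm_prodHom_le (x : A ⊗[ℂ] B) :
    ‖prodHom π ρ x‖ ≤ ((allReps A).prod (allReps B)).sup x :=
  ((allReps A).prod (allReps B)).le_sup x ((⟨H, π⟩, ⟨K, ρ⟩) : Rep A × Rep B)

theorem norm_prodHom₃_le (x : (A ⊗[ℂ] B) ⊗[ℂ] C) :
    ‖prodHom (prodHom π ρ) σ x‖ ≤ (((allReps A).prod (allReps B)).prod (allReps C)).sup x :=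
  (((allReps A).prod (allReps B)).prod (allReps C)).le_sup x
    (((⟨H, π⟩, ⟨K, ρ⟩), ⟨L, σ⟩) : (Rep A × Rep B) × Rep C)

/-- The representation `π ⊗ ρ` of the spatial tensor product. -/
def spatialRep : Spatial A B →⋆ₐ[ℂ] (HTensor H K →L[ℂ] HTensor H K) :=
  ((allReps A).prod (allReps B)).extend (D := HTensor H K →L[ℂ] HTensor H K)
    (prodHom π ρ) (norm_prodHom_le π ρ)

theorem spatialRep_of (x : A ⊗[ℂ] B) : spatialRep π ρ (spatialOf A B x) = prodHom π ρ x :=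
  ((allReps A).prod (allReps B)).extend_of
    (D := HTensor H K →L[ℂ] HTensor H K) (prodHom π ρ) (norm_prodHom_le π ρ) x

/-- The representation `π ⊗ ρ ⊗ σ` of the triple spatial tensor product. -/
def spatialRep₃ : Spatial₃ A B C →⋆ₐ[ℂ]
    (HTensor (HTensor H K) L →L[ℂ] HTensor (HTensor H K) L) :=
  (((allReps A).prod (allReps B)).prod (allReps C)).extend
    (D := HTensor (HTensor H K) L →L[ℂ] HTensor (HTensor H K) L) (prodHom (prodHom π ρ) σ)
    (norm_prodHom₃_le π ρ σ)

theorem spatialRep₃_of (x : (A ⊗[ℂ] B) ⊗[ℂ] C) :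
    spatialRep₃ π ρ σ (spatialOf₃ A B C x) = prodHom (prodHom π ρ) σ x :=
  (((allReps A).prod (allReps B)).prod (allReps C)).extend_of
    (D := HTensor (HTensor H K) L →L[ℂ] HTensor (HTensor H K) L) (prodHom (prodHom π ρ) σ)
    (norm_prodHom₃_le π ρ σ) x

theorem norm_spatialOf₃_le (x : (A ⊗[ℂ] B) ⊗[ℂ] C) {r : ℝ} (hr : 0 ≤ r)
    (h : ∀ (π : Rep A) (ρ : Rep B) (σ : Rep C), ‖prodHom (prodHom π.hom ρ.hom) σ.hom x‖ ≤ r) :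
    ‖spatialOf₃ A B C x‖ ≤ r :=
  (RepFamily.norm_of _ x).trans_le (RepFamily.sup_le _ hr fun i => h i.1.1 i.1.2 i.2)

theorem norm_spatial₃_le (x : Spatial₃ A B C) {r : ℝ} (hr : 0 ≤ r)
    (h : ∀ (π : Rep A) (ρ : Rep B) (σ : Rep C), ‖spatialRep₃ π.hom ρ.hom σ.hom x‖ ≤ r) :
    ‖x‖ ≤ r :=
  RepFamily.norm_le_of_extRep _ x hr fun i => h i.1.1 i.1.2 i.2

theorem norm_one_le {H : Type u} [NormedAddCommGroup H] [InnerProductSpace ℂ H] :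
    ‖(1 : H →L[ℂ] H)‖ ≤ 1 := ContinuousLinearMap.norm_id_le

theorem continuous_hom {D E : Type u} [CStarAlgebra D] [CStarAlgebra E] (φ : D →⋆ₐ[ℂ] E) :
    Continuous φ :=
  AddMonoidHomClass.continuous_of_bound φ 1 fun x => by
    rw [one_mul]; exact NonUnitalStarAlgHom.norm_apply_le φ x

theorem prodHom_tmul_one (x : A ⊗[ℂ] B) :
    prodHom (prodHom π ρ) σ (x ⊗ₜ 1) = opTensor (prodHom π ρ x) 1 := by
  rw [prodHom_tmul, map_one]

variable (A B C) in
/-- `x ↦ x ⊗ 1` from the spatial tensor product of the first two factors. -/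
def leg₁₂ : Spatial A B →⋆ₐ[ℂ] Spatial₃ A B C :=
  ((allReps A).prod (allReps B)).extend ((spatialOf₃ A B C).comp (algLeft (A ⊗[ℂ] B) C)) fun x =>
    norm_spatialOf₃_le _ (RepFamily.sup_nonneg _ _) fun π ρ σ =>
      (congrArg norm (prodHom_tmul_one π.hom ρ.hom σ.hom x)).trans_le
        ((opTensor_norm_le _ _).trans
          ((mul_le_of_le_one_right (norm_nonneg _) norm_one_le).trans
            (norm_prodHom_le π.hom ρ.hom x)))

theorem leg₁₂_of (x : A ⊗[ℂ] B) : leg₁₂ A B C (spatialOf A B x) = spatialOf₃ A B C (x ⊗ₜ 1) :=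
  RepFamily.extend_of _ ((spatialOf₃ A B C).comp (algLeft (A ⊗[ℂ] B) C)) _ x

variable (A B C) in
/-- `c ↦ 1 ⊗ 1 ⊗ c`. -/
def leg₃ : C →⋆ₐ[ℂ] Spatial₃ A B C := (spatialOf₃ A B C).comp (algRight (A ⊗[ℂ] B) C)

variable (A B C) in
/-- `a ↦ a ⊗ 1 ⊗ 1`. -/
def leg₁ : A →⋆ₐ[ℂ] Spatial₃ A B C :=
  (spatialOf₃ A B C).comp ((algLeft (A ⊗[ℂ] B) C).comp (algLeft A B))

variable (A B C) in
/-- `b ⊗ c ↦ 1 ⊗ b ⊗ c` on algebraic tensor products. -/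
def algLeg₂₃ : (B ⊗[ℂ] C) →⋆ₐ[ℂ] ((A ⊗[ℂ] B) ⊗[ℂ] C) :=
  liftStar ((algLeft (A ⊗[ℂ] B) C).comp (algRight A B)) (algRight (A ⊗[ℂ] B) C) fun b c => by
    change ((1 : A) ⊗ₜ[ℂ] b) ⊗ₜ[ℂ] (1 : C) * (1 : A ⊗[ℂ] B) ⊗ₜ[ℂ] c =
      (1 : A ⊗[ℂ] B) ⊗ₜ[ℂ] c * ((1 : A) ⊗ₜ[ℂ] b) ⊗ₜ[ℂ] (1 : C)
    simp only [Algebra.TensorProduct.tmul_mul_tmul, one_mul, mul_one]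

theorem algLeg₂₃_tmul (b : B) (c : C) : algLeg₂₃ A B C (b ⊗ₜ c) = ((1 : A) ⊗ₜ b) ⊗ₜ c := by
  refine (liftStar_tmul _ _ _ _ _).trans ?_
  change ((1 : A) ⊗ₜ[ℂ] b) ⊗ₜ[ℂ] (1 : C) * (1 : A ⊗[ℂ] B) ⊗ₜ[ℂ] c = _
  simp only [Algebra.TensorProduct.tmul_mul_tmul, one_mul, mul_one]

theorem hassoc_algLeg₂₃ (x : B ⊗[ℂ] C) (v : HTensor (HTensor H K) L) :
    hassoc H K L (prodHom (prodHom π ρ) σ (algLeg₂₃ A B C x) v) =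
      ampRight H (HTensor K L) (prodHom ρ σ x) (hassoc H K L v) := by
  induction x with
  | zero => simp only [map_zero, _root_.zero_apply]
  | add x y hx hy => simp only [map_add, _root_.add_apply, hx, hy]
  | tmul b c =>
    rw [algLeg₂₃_tmul, prodHom_tmul, prodHom_tmul, prodHom_tmul, map_one]
    exact hassoc_opTensor _ _ _ v

theorem norm_le_of_hassoc {H K L : Type u} [NormedAddCommGroup H] [InnerProductSpace ℂ H]
    [NormedAddCommGroup K] [InnerProductSpace ℂ K] [NormedAddCommGroup L] [InnerProductSpace ℂ L]
    (S : HTensor (HTensor H K) L →L[ℂ] HTensor (HTensor H K) L)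
    (T : HTensor H (HTensor K L) →L[ℂ] HTensor H (HTensor K L))
    (h : ∀ v, hassoc H K L (S v) = T (hassoc H K L v)) : ‖S‖ ≤ ‖T‖ :=
  ContinuousLinearMap.opNorm_le_bound _ (ContinuousLinearMap.opNorm_nonneg T) fun v => by
    rw [← (hassoc H K L).norm_map (S v), h, ← (hassoc H K L).norm_map v]
    exact T.le_opNorm _

variable (A B C) in
/-- `x ↦ 1 ⊗ x` from the spatial tensor product of the last two factors. -/
def leg₂₃ : Spatial B C →⋆ₐ[ℂ] Spatial₃ A B C :=
  ((allReps B).prod (allReps C)).extend ((spatialOf₃ A B C).comp (algLeg₂₃ A B C)) fun x =>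
    norm_spatialOf₃_le _ (RepFamily.sup_nonneg _ _) fun π ρ σ =>
      (norm_le_of_hassoc _ _ (hassoc_algLeg₂₃ π.hom ρ.hom σ.hom x)).trans
        ((NonUnitalStarAlgHom.norm_apply_le (ampRight π.H (HTensor ρ.H σ.H))
          (prodHom ρ.hom σ.hom x)).trans (norm_prodHom_le ρ.hom σ.hom x))

theorem leg₂₃_of (x : B ⊗[ℂ] C) :
    leg₂₃ A B C (spatialOf B C x) = spatialOf₃ A B C (algLeg₂₃ A B C x) :=
  RepFamily.extend_of _ ((spatialOf₃ A B C).comp (algLeg₂₃ A B C)) _ x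

theorem spatialRep₃_leg₁₂ (x : Spatial A B) :
    spatialRep₃ π ρ σ (leg₁₂ A B C x) = ampLeft (HTensor H K) L (spatialRep π ρ x) := by
  refine RepFamily.induction _ (p := fun x => spatialRep₃ π ρ σ (leg₁₂ A B C x) =
    ampLeft (HTensor H K) L (spatialRep π ρ x)) (isClosed_eq
    ((continuous_hom (spatialRep₃ π ρ σ)).comp (continuous_hom (leg₁₂ A B C)))
    ((continuous_hom (ampLeft (HTensor H K) L)).comp
      (continuous_hom (spatialRep π ρ)))) (fun b => ?_) x
  change spatialRep₃ π ρ σ (leg₁₂ A B C (spatialOf A B b)) =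
    ampLeft (HTensor H K) L (spatialRep π ρ (spatialOf A B b))
  rw [leg₁₂_of, spatialRep₃_of, spatialRep_of, prodHom_tmul_one]
  rfl

theorem spatialRep₃_leg₃ (c : C) :
    spatialRep₃ π ρ σ (leg₃ A B C c) = ampRight (HTensor H K) L (σ c) := by
  refine (spatialRep₃_of π ρ σ _).trans ((prodHom_tmul _ _ _ _).trans ?_)
  rw [map_one]
  rfl

theorem hassoc_leg₁ (a : A) (v : HTensor (HTensor H K) L) :
    hassoc H K L (spatialRep₃ π ρ σ (leg₁ A B C a) v) =
      ampLeft H (HTensor K L) (π a) (hassoc H K L v) := by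
  have h : spatialRep₃ π ρ σ (leg₁ A B C a) =
      opTensor (opTensor (π a) (1 : K →L[ℂ] K)) (1 : L →L[ℂ] L) := by
    refine (spatialRep₃_of π ρ σ _).trans ((prodHom_tmul_one π ρ σ _).trans ?_)
    refine congrArg (fun T => opTensor T (1 : L →L[ℂ] L)) ((prodHom_tmul π ρ a 1).trans ?_)
    rw [map_one]
  rw [h, hassoc_opTensor, opTensor_one]
  rfl

theorem hassoc_leg₂₃ (x : Spatial B C) (v : HTensor (HTensor H K) L) :
    hassoc H K L (spatialRep₃ π ρ σ (leg₂₃ A B C x) v) =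
      ampRight H (HTensor K L) (spatialRep ρ σ x) (hassoc H K L v) := by
  refine RepFamily.induction _ (p := fun x =>
    hassoc H K L (spatialRep₃ π ρ σ (leg₂₃ A B C x) v) =
      ampRight H (HTensor K L) (spatialRep ρ σ x) (hassoc H K L v)) (isClosed_eq
    ((hassoc H K L).continuous.comp
      (((continuous_hom (spatialRep₃ π ρ σ)).comp (continuous_hom (leg₂₃ A B C))).clm_apply
        continuous_const))
    (((continuous_hom (ampRight H (HTensor K L))).comp
      (continuous_hom (spatialRep ρ σ))).clm_apply continuous_const)) (fun b => ?_) x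
  change hassoc H K L (spatialRep₃ π ρ σ (leg₂₃ A B C (spatialOf B C b)) v) =
    ampRight H (HTensor K L) (spatialRep ρ σ (spatialOf B C b)) (hassoc H K L v)
  rw [leg₂₃_of, spatialRep₃_of, spatialRep_of]
  exact hassoc_algLeg₂₃ π ρ σ b v

theorem commute_leg₁₂_leg₃ (x : Spatial A B) (c : C) :
    Commute (leg₁₂ A B C x) (leg₃ A B C c) := by
  refine RepFamily.induction _ (p := fun x => leg₁₂ A B C x * leg₃ A B C c =
    leg₃ A B C c * leg₁₂ A B C x) (isClosed_eq ((continuous_hom _).mul continuous_const)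
      (continuous_const.mul (continuous_hom _))) (fun b => ?_) x
  change leg₁₂ A B C (spatialOf A B b) * _ = _ * leg₁₂ A B C (spatialOf A B b)
  rw [leg₁₂_of]
  change spatialOf₃ A B C _ * spatialOf₃ A B C (1 ⊗ₜ c) =
    spatialOf₃ A B C (1 ⊗ₜ c) * spatialOf₃ A B C _
  rw [← map_mul, ← map_mul]
  simp only [Algebra.TensorProduct.tmul_mul_tmul, one_mul, mul_one]

theorem commute_leg₁_leg₂₃ (a : A) (x : Spatial B C) :
    Commute (leg₁ A B C a) (leg₂₃ A B C x) := by
  refine RepFamily.induction _ (p := fun x => leg₁ A B C a * leg₂₃ A B C x =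
    leg₂₃ A B C x * leg₁ A B C a) (isClosed_eq (continuous_const.mul (continuous_hom _))
      ((continuous_hom _).mul continuous_const)) (fun b => ?_) x
  change _ * leg₂₃ A B C (spatialOf B C b) = leg₂₃ A B C (spatialOf B C b) * _
  rw [leg₂₃_of]
  change spatialOf₃ A B C ((a ⊗ₜ 1) ⊗ₜ 1) * _ = _ * spatialOf₃ A B C ((a ⊗ₜ 1) ⊗ₜ 1)
  rw [← map_mul, ← map_mul]
  congr 1
  induction b with
  | zero => simp
  | add x y hx hy => rw [map_add, mul_add, add_mul, hx, hy]
  | tmul b c =>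
    rw [algLeg₂₃_tmul]
    simp only [Algebra.TensorProduct.tmul_mul_tmul, one_mul, mul_one]

variable {D : Type u} [CStarAlgebra D]

/-- `φ ⊗ ι` on the algebraic tensor product. -/
def algTensorId (φ : D →⋆ₐ[ℂ] Spatial A B) (C : Type u) [CStarAlgebra C] :
    (D ⊗[ℂ] C) →⋆ₐ[ℂ] Spatial₃ A B C :=
  liftStar ((leg₁₂ A B C).comp φ) (leg₃ A B C) fun d c => commute_leg₁₂_leg₃ (φ d) c

theorem algTensorId_tmul (φ : D →⋆ₐ[ℂ] Spatial A B) (d : D) (c : C) :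
    algTensorId φ C (d ⊗ₜ c) = leg₁₂ A B C (φ d) * leg₃ A B C c :=
  liftStar_tmul _ _ _ _ _

theorem spatialRep₃_algTensorId (φ : D →⋆ₐ[ℂ] Spatial A B) (x : D ⊗[ℂ] C) :
    spatialRep₃ π ρ σ (algTensorId φ C x) = prodHom ((spatialRep π ρ).comp φ) σ x := by
  induction x with
  | zero => simp only [map_zero]
  | add x y hx hy => simp only [map_add, hx, hy]
  | tmul d c =>
    rw [algTensorId_tmul, map_mul, prodHom_tmul, spatialRep₃_leg₃, spatialRep₃_leg₁₂]
    exact (opTensor_mul _ _ _ _).symm.trans (by rw [one_mul, mul_one]; rfl)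

/-- `φ ⊗ ι : D ⊗ C → A ⊗ B ⊗ C` for a unital `*`-homomorphism `φ : D → A ⊗ B`. -/
def tensorId (φ : D →⋆ₐ[ℂ] Spatial A B) (C : Type u) [CStarAlgebra C] :
    Spatial D C →⋆ₐ[ℂ] Spatial₃ A B C :=
  ((allReps D).prod (allReps C)).extend (algTensorId φ C) fun x =>
    norm_spatial₃_le _ (RepFamily.sup_nonneg _ _) fun π ρ σ =>
      (congrArg norm (spatialRep₃_algTensorId π.hom ρ.hom σ.hom φ x)).trans_le
        (norm_prodHom_le ((spatialRep π.hom ρ.hom).comp φ) σ.hom x)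

/-- `ι ⊗ ψ` on the algebraic tensor product. -/
def algIdTensor (A : Type u) [CStarAlgebra A] (ψ : D →⋆ₐ[ℂ] Spatial B C) :
    (A ⊗[ℂ] D) →⋆ₐ[ℂ] Spatial₃ A B C :=
  liftStar (leg₁ A B C) ((leg₂₃ A B C).comp ψ) fun a d => commute_leg₁_leg₂₃ a (ψ d)

theorem algIdTensor_tmul (ψ : D →⋆ₐ[ℂ] Spatial B C) (a : A) (d : D) :
    algIdTensor A ψ (a ⊗ₜ d) = leg₁ A B C a * leg₂₃ A B C (ψ d) :=
  liftStar_tmul _ _ _ _ _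

theorem hassoc_algIdTensor (ψ : D →⋆ₐ[ℂ] Spatial B C) (x : A ⊗[ℂ] D)
    (v : HTensor (HTensor H K) L) :
    hassoc H K L (spatialRep₃ π ρ σ (algIdTensor A ψ x) v) =
      prodHom π ((spatialRep ρ σ).comp ψ) x (hassoc H K L v) := by
  induction x with
  | zero => simp only [map_zero, _root_.zero_apply]
  | add x y hx hy => simp only [map_add, _root_.add_apply, hx, hy]
  | tmul a d =>
    rw [algIdTensor_tmul, map_mul, prodHom_tmul]
    refine (hassoc_leg₁ π ρ σ a _).trans ?_
    refine (congrArg _ (hassoc_leg₂₃ π ρ σ (ψ d) v)).trans ?_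
    have h := opTensor_mul (π a) 1 (1 : HTensor K L →L[ℂ] HTensor K L) (spatialRep ρ σ (ψ d))
    rw [mul_one, one_mul] at h
    exact (congrArg (fun T => T (hassoc H K L v)) h).symm

/-- `ι ⊗ ψ : A ⊗ D → A ⊗ B ⊗ C` for a unital `*`-homomorphism `ψ : D → B ⊗ C`. -/
def idTensor (A : Type u) [CStarAlgebra A] (ψ : D →⋆ₐ[ℂ] Spatial B C) :
    Spatial A D →⋆ₐ[ℂ] Spatial₃ A B C :=
  ((allReps A).prod (allReps D)).extend (algIdTensor A ψ) fun x =>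
    norm_spatial₃_le _ (RepFamily.sup_nonneg _ _) fun π ρ σ =>
      (norm_le_of_hassoc _ _ (hassoc_algIdTensor π.hom ρ.hom σ.hom ψ x)).trans
        (norm_prodHom_le π.hom ((spatialRep ρ.hom σ.hom).comp ψ) x)

/-- `(φ ⊗ ι)(d ⊗ c) = φ(d) ⊗ c`. -/
theorem tensorId_tens (φ : D →⋆ₐ[ℂ] Spatial A B) (d : D) (c : C) :
    tensorId φ C (tens d c) = leg₁₂ A B C (φ d) * leg₃ A B C c :=
  (RepFamily.extend_of _ (algTensorId φ C) _ _).trans (algTensorId_tmul φ d c)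

/-- `(ι ⊗ ψ)(a ⊗ d) = a ⊗ ψ(d)`. -/
theorem idTensor_tens (ψ : D →⋆ₐ[ℂ] Spatial B C) (a : A) (d : D) :
    idTensor A ψ (tens a d) = leg₁ A B C a * leg₂₃ A B C (ψ d) :=
  (RepFamily.extend_of _ (algIdTensor A ψ) _ _).trans (algIdTensor_tmul ψ a d)

end Maps

section QuantumGroups

/-- The closed linear span in `A ⊗ B` of the elementary tensors `s ⊗ b` with `s ∈ S`, `b ∈ B`. For a
closed subspace `S` of `A` this is the space `S ⊗ B`. -/
def tensorWith {A : Type u} [CStarAlgebra A] (S : Set A) (B : Type u) [CStarAlgebra B] :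
    Submodule ℂ (Spatial A B) :=
  (Submodule.span ℂ {x | ∃ s ∈ S, ∃ b : B, x = tens s b}).topologicalClosure

/-- A compact quantum group `(A, Δ)`: a unital C*-algebra `A` with a unital `*`-homomorphism
`Δ : A → A ⊗ A` (spatial tensor product) such that `(Δ ⊗ ι)Δ = (ι ⊗ Δ)Δ` and such that
`(A ⊗ I)Δ(A)` and `(I ⊗ A)Δ(A)` span dense subspaces of `A ⊗ A`. -/
structure CompactQuantumGroup (A : Type u) [CStarAlgebra A] where
  comul : A →⋆ₐ[ℂ] Spatial A A
  coassoc : ∀ a, tensorId comul A (comul a) = idTensor A comul (comul a)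
  dense_left : (Submodule.span ℂ
    {x | ∃ b c : A, x = tens b 1 * comul c}).topologicalClosure = ⊤
  dense_right : (Submodule.span ℂ
    {x | ∃ b c : A, x = tens 1 b * comul c}).topologicalClosure = ⊤

variable {C A : Type u} [CStarAlgebra C] [CStarAlgebra A]

/-- An action of a compact quantum group `(A, Δ)` on a unital C*-algebra `C`: a unital
`*`-homomorphism `δ : C → C ⊗ A` with `(δ ⊗ ι)δ = (ι ⊗ Δ)δ`. -/
structure Action (G : CompactQuantumGroup A) (C : Type u) [CStarAlgebra C] where
  hom : C →⋆ₐ[ℂ] Spatial C A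
  coassoc : ∀ c, tensorId hom A (hom c) = idTensor C G.comul (hom c)

namespace Action

variable {G : CompactQuantumGroup A} (δ : Action G C)

/-- The closed linear span of `(I ⊗ A) δ(S)`. -/
def spanImage (S : Set C) : Submodule ℂ (Spatial C A) :=
  (Submodule.span ℂ {x | ∃ a : A, ∃ s ∈ S, x = tens 1 a * δ.hom s}).topologicalClosure

/-- The linear span of `(I ⊗ A) δ(C)` is dense in `C ⊗ A`. -/
def Nondegenerate : Prop := δ.spanImage Set.univ = ⊤

/-- The fixed points `{c : δ(c) = c ⊗ I}`. -/
def fixedPoints : Set C := {c | δ.hom c = tens c 1}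

/-- `δ(S) ⊆ S ⊗ A`. -/
def Invariant (S : Set C) : Prop := ∀ s ∈ S, δ.hom s ∈ tensorWith S A

/-- The fixed point algebra consists of the scalars. -/
def Ergodic : Prop := δ.fixedPoints = Set.range (algebraMap ℂ C)

end Action

end QuantumGroups

section Hereditary

/-- The positive elements `z* z` of a C*-algebra. -/
def IsPos {B : Type u} [CStarAlgebra B] (x : B) : Prop := ∃ z : B, x = star z * z

/-- A hereditary C*-subalgebra: a closed `*`-subalgebra `H` (not required to contain the unit) such
that `0 ≤ b ≤ h` and `h ∈ H` imply `b ∈ H`. -/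
structure IsHereditary {B : Type u} [CStarAlgebra B] (H : NonUnitalStarSubalgebra ℂ B) : Prop where
  isClosed : IsClosed (H : Set B)
  mem_of_le : ∀ b h : B, IsPos b → IsPos (h - b) → h ∈ H → b ∈ H

/-- The hereditary C*-subalgebra generated by a set. -/
def hereditaryHull {B : Type u} [CStarAlgebra B] (S : Set B) : NonUnitalStarSubalgebra ℂ B :=
  sInf {H | IsHereditary H ∧ S ⊆ H}

theorem isHereditary_hereditaryHull {B : Type u} [CStarAlgebra B] (S : Set B) :
    IsHereditary (hereditaryHull S) := by
  constructor
  · rw [hereditaryHull, NonUnitalStarAlgebra.coe_sInf]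
    exact isClosed_biInter fun H hH => hH.1.isClosed
  · intro b h hb hh hm
    rw [hereditaryHull, NonUnitalStarAlgebra.mem_sInf] at hm ⊢
    exact fun H hH => hH.1.mem_of_le b h hb hh (hm H hH)

theorem subset_hereditaryHull {B : Type u} [CStarAlgebra B] (S : Set B) :
    S ⊆ hereditaryHull S := fun s hs => by
  rw [SetLike.mem_coe, hereditaryHull, NonUnitalStarAlgebra.mem_sInf]
  exact fun H hH => hH.2 hs

end Hereditary

section Bidual

variable (B : Type u) [CStarAlgebra B]

/-- The enveloping von Neumann algebra `B''`, realized as the second dual of `B`. -/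
abbrev Bidual : Type u := StrongDual ℂ (StrongDual ℂ B)

variable {B}

/-- The canonical embedding of `B` into `B''`. -/
def toBidual : B →L[ℂ] Bidual B := NormedSpace.inclusionInDoubleDual ℂ B

/-- The functional `b ↦ f(ab)`. -/
def dualMul (f : StrongDual ℂ B) : B →L[ℂ] StrongDual ℂ B :=
  (ContinuousLinearMap.compL ℂ B B ℂ f).comp (ContinuousLinearMap.mul ℂ B)

theorem dualMul_apply (f : StrongDual ℂ B) (a b : B) : dualMul f a b = f (a * b) := rfl

/-- For `Ψ ∈ B''`, the map taking `f ∈ B'` to the functional `a ↦ Ψ(b ↦ f(ab))`. -/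
def bidualSlice (Ψ : Bidual B) : StrongDual ℂ B →L[ℂ] StrongDual ℂ B :=
  (ContinuousLinearMap.compL ℂ B (StrongDual ℂ B) ℂ Ψ).comp
    (((ContinuousLinearMap.compL ℂ B (B →L[ℂ] B) (StrongDual ℂ B)).flip
      (ContinuousLinearMap.mul ℂ B)).comp (ContinuousLinearMap.compL ℂ B B ℂ))

theorem bidualSlice_apply (Ψ : Bidual B) (f : StrongDual ℂ B) (a : B) :
    bidualSlice Ψ f a = Ψ (dualMul f a) := rfl

/-- The product of `B''` (the Arens product on the second dual). -/
def bidualMul (Φ Ψ : Bidual B) : Bidual B := Φ.comp (bidualSlice Ψ)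

theorem bidualMul_toBidual (a b : B) :
    bidualMul (toBidual a) (toBidual b) = toBidual (a * b) := rfl

/-- The functional `f*(a) = conj f(a*)`. -/
def dualStar (f : StrongDual ℂ B) : StrongDual ℂ B :=
  LinearMap.mkContinuous
    { toFun a := star (f (star a))
      map_add' a b := by simp
      map_smul' c a := by simp } ‖f‖ fun a => by
    simpa using f.le_opNorm (star a)

theorem dualStar_apply (f : StrongDual ℂ B) (a : B) : dualStar f a = star (f (star a)) := rfl

/-- The adjoint of `B''`: `Φ*(f) = conj Φ(f*)`. -/
def bidualStar (Φ : Bidual B) : Bidual B :=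
  LinearMap.mkContinuous
    { toFun f := star (Φ (dualStar f))
      map_add' f g := by
        have : dualStar (f + g) = dualStar f + dualStar g := by ext; simp [dualStar_apply]
        simp [this]
      map_smul' c f := by
        have : dualStar (c • f) = star c • dualStar f := by ext; simp [dualStar_apply]
        simp [this] } ‖Φ‖ fun f => by
    have : ‖dualStar f‖ ≤ ‖f‖ := LinearMap.mkContinuous_norm_le _ (norm_nonneg _) _
    simpa using (Φ.le_opNorm (dualStar f)).trans (mul_le_mul_of_nonneg_left this (norm_nonneg _))

theorem bidualStar_apply (Φ : Bidual B) (f : StrongDual ℂ B) :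
    bidualStar Φ f = star (Φ (dualStar f)) := rfl

theorem bidualStar_toBidual (a : B) : bidualStar (toBidual a) = toBidual (star a) := by
  ext f
  change star (star (f (star a))) = f (star a)
  rw [star_star]

/-- The normal extension `φ'' : B'' → D''` of a unital `*`-homomorphism `φ : B → D`, which is the
second transpose of `φ`. -/
def bidualMap {D : Type u} [CStarAlgebra D] (φ : B →⋆ₐ[ℂ] D) : Bidual B →L[ℂ] Bidual D :=
  (ContinuousLinearMap.compL ℂ (StrongDual ℂ D) (StrongDual ℂ B) ℂ).flip
    ((ContinuousLinearMap.compL ℂ B D ℂ).flip ⟨φ.toAlgHom.toLinearMap, continuous_hom φ⟩)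

theorem bidualMap_toBidual {D : Type u} [CStarAlgebra D] (φ : B →⋆ₐ[ℂ] D) (b : B) :
    bidualMap φ (toBidual b) = toBidual (φ b) := rfl

/-- A projection of `B''`. -/
def IsProj (p : Bidual B) : Prop := bidualMul p p = p ∧ bidualStar p = p

/-- A projection of `B''` is open if it is the limit of an increasing net of positive elements of
`B`, in the weak-* (σ-weak) topology of `B''`; for bounded increasing nets this is the same as
the strong limit. -/
def IsOpenProj (p : Bidual B) : Prop :=
  IsProj p ∧ ∃ (ι : Type u) (_ : Preorder ι) (_ : IsDirectedOrder ι) (_ : Nonempty ι) (x : ι → B),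
    (∀ i, IsPos (x i)) ∧ (∀ i j, i ≤ j → IsPos (x j - x i)) ∧
    ∀ f : StrongDual ℂ B, Filter.Tendsto (fun i => f (x i)) Filter.atTop (nhds (p f))

end Bidual

end QuantumAction

end

/-! Two constructions carry the theorem: averaging over the Haar state, and functional calculus of a
non-scalar fixed element.

From (a) to the other properties. The Haar state h satisfies (ι ⊗ h)Δ(a) = h(a)1, so E = (ι ⊗ h)δ
maps C into the fixed points (`average_mem_fixedPoints`), hence into the scalars. Let I be a proper
ideal as in (b). For s in I the element E(s*s) lies in I and is a scalar, hence is 0. So (f ⊗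
h)(δ(s)*δ(s)) = f(E(s*s)) = 0 for every positive functional f, and δ(I) lies in the left kernel of f
⊗ h. This is a closed left ideal, so it contains I ⊗ A and in particular x ⊗ 1 for x in I. Therefore
f(x*x) = 0 for all f, and x = 0. For (c) the left kernel is replaced by its intersection with its
adjoint, which is hereditary. For (d), evaluating δ''(p) = p ⊗ 1 at φ ∘ (ι ⊗ h) gives p(φ ∘ E) =
p(φ); as E is scalar-valued, p is a multiple of 1.

From the other properties to (a). If a fixed element is not a scalar, there is a self-adjoint one,
a, with two distinct spectral points. Let r be their midpoint. Ramp functions vanishing on (-∞, r]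
give fixed elements e_n, increasing, with e_n e_m = e_n for large m, while g = (r - a)₊ is nonzero
and e_n g = 0 (`exists_supportUnit_of_not_ergodic`). The forbidden objects are the left ideal {x : x
e_n → x}, its intersection with its adjoint, and the weak-* limit of e_n in C''. All invariance
statements come from δ(e_n) = e_n ⊗ 1. The density of (I ⊗ A)δ(C) enters in the construction of the
ideal (`spanImage_ideal`).

The Haar state (`exists_haar`) comes from Cesàro means of convolution powers, a Cauchy-Schwarz
argument that passes from a functional to those it dominates (`conv_eq_of_dominated`), and weak-*
compactness. Slice maps ι ⊗ f for positive f are built by hand on the spatial tensor product, using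
vector representations of f. -/

namespace QuantumAction

/-! ### Positive functionals, GNS representations and the Gelfand-Naimark norm formula -/

section PositiveFunctionals

open scoped ComplexOrder

noncomputable section

/-- A positive functional on a unital C*-algebra. -/
structure PosFunctional (A : Type u) [CStarAlgebra A] where
  toDual : StrongDual ℂ A
  nonneg : ∀ a, 0 ≤ toDual (star a * a)

variable {A : Type u} [CStarAlgebra A]

instance : CoeFun (PosFunctional A) fun _ => A → ℂ := ⟨fun f => f.toDual⟩

theorem exists_eq_star_mul_self_sub (z : A) :
    ∃ w : A, ((‖z‖ ^ 2 : ℝ) : ℂ) • (1 : A) - star z * z = star w * w := by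
  let _ := CStarAlgebra.spectralOrder A
  have _ := CStarAlgebra.spectralOrderedRing A
  have h := sub_nonneg.mpr (CStarAlgebra.star_mul_le_algebraMap_norm_sq (a := z))
  obtain ⟨w, hw⟩ := CStarAlgebra.nonneg_iff_eq_star_mul_self.mp h
  refine ⟨w, ?_⟩
  rw [← hw, Algebra.algebraMap_eq_smul_one, Complex.coe_smul]

/-- The real functional `Re ψ` is nonnegative on positive elements when `‖ψ‖ ≤ 1 = ψ(1)`. -/
theorem re_nonneg_of_norm_le_one {ψ : StrongDual ℂ A} (hψ : ‖ψ‖ ≤ 1) (h1 : ψ 1 = 1) (a : A) :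
    0 ≤ (ψ (star a * a)).re := by
  let _ := CStarAlgebra.spectralOrder A
  have _ := CStarAlgebra.spectralOrderedRing A
  -- If 0 ≤ x ≤ 1 then ‖1 - x‖ ≤ 1, so 1 - Re ψ(x) ≤ 1. The general case follows by scaling.
  have key : ∀ x : A, 0 ≤ x → ‖x‖ ≤ 1 → 0 ≤ (ψ x).re := fun x hx hx1 => by
    have h2 : x ≤ 1 := by simpa using (CStarAlgebra.norm_le_iff_le_algebraMap x zero_le_one).mp hx1
    have h3 : ‖1 - x‖ ≤ 1 := by
      rw [CStarAlgebra.norm_le_iff_le_algebraMap (1 - x) zero_le_one (sub_nonneg.mpr h2)]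
      simpa using hx
    have h4 : (ψ (1 - x)).re ≤ 1 := (Complex.re_le_norm _).trans
      ((ψ.le_opNorm _).trans (mul_le_one₀ hψ (norm_nonneg _) h3))
    rw [map_sub, h1, Complex.sub_re, Complex.one_re] at h4
    linarith
  rcases eq_or_ne a 0 with rfl | ha
  · simp
  have hpos : 0 < ‖star a * a‖ := by
    rw [CStarRing.norm_star_mul_self]; have := norm_pos_iff.mpr ha; positivity
  have := key (‖star a * a‖⁻¹ • (star a * a)) (smul_nonneg (by positivity) (star_mul_self_nonneg a))
    (by rw [norm_smul, norm_inv, norm_norm, inv_mul_cancel₀ hpos.ne'])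
  rw [← Complex.coe_smul, map_smul, smul_eq_mul, Complex.re_ofReal_mul] at this
  exact nonneg_of_mul_nonneg_right this (inv_pos.mpr hpos)

/-- From 1 + z*z ≤ ‖1 + z*z‖ one gets z*z ≤ ‖1 + z*z‖ - 1, which is the nontrivial inequality.
Nontriviality of A gives ‖1‖ = 1. -/
theorem norm_one_add_of_nonneg [Nontrivial A] (z : A) :
    ‖1 + star z * z‖ = 1 + ‖star z * z‖ := by
  let _ := CStarAlgebra.spectralOrder A
  have _ := CStarAlgebra.spectralOrderedRing A
  have hz := star_mul_self_nonneg z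
  refine le_antisymm ((norm_add_le _ _).trans (by rw [norm_one])) ?_
  have h0 : (0 : A) ≤ 1 + star z * z := add_nonneg zero_le_one hz
  have h1 := (CStarAlgebra.norm_le_iff_le_algebraMap _ (norm_nonneg _) h0).mp le_rfl
  have h2 : 1 ≤ ‖1 + star z * z‖ := by
    have : ‖(1 : A)‖ ≤ ‖1 + star z * z‖ :=
      CStarAlgebra.norm_le_norm_of_nonneg_of_le zero_le_one (le_add_of_nonneg_right hz)
    rwa [norm_one] at this
  have h3 : ‖star z * z‖ ≤ ‖1 + star z * z‖ - 1 := by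
    rw [CStarAlgebra.norm_le_iff_le_algebraMap _ (sub_nonneg.mpr h2) hz, map_sub, map_one]
    exact le_sub_iff_add_le'.mpr h1
  linarith

/-- A Hahn-Banach functional ψ norming 1 + c*c must have ψ(1) = 1 and Re ψ(c*c) = ‖c*c‖, because the
norm of the sum is the sum of the norms. Its Hermitian part is then the desired state. -/
theorem exists_state [Nontrivial A] (c : A) :
    ∃ f : PosFunctional A, f 1 = 1 ∧ f (star c * c) = ((‖c‖ ^ 2 : ℝ) : ℂ) := by
  obtain ⟨ψ, hψ, h⟩ := exists_dual_vector'' ℂ (1 + star c * c)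
  rw [norm_one_add_of_nonneg, map_add] at h
  have hre := congrArg Complex.re h
  have e1 : ‖ψ 1‖ ≤ 1 := by
    have := ψ.le_opNorm 1; rw [norm_one, mul_one] at this; exact this.trans hψ
  have e2 : ‖ψ (star c * c)‖ ≤ ‖star c * c‖ :=
    (ψ.le_opNorm _).trans (mul_le_of_le_one_left (norm_nonneg _) hψ)
  have r1 := Complex.re_le_norm (ψ 1)
  have r2 := Complex.re_le_norm (ψ (star c * c))
  simp only [Complex.add_re, Complex.coe_algebraMap, Complex.ofReal_re] at hre
  have f1 : (ψ 1).re = 1 := by linarith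
  have f2 : (ψ (star c * c)).re = ‖star c * c‖ := by linarith
  have g1 : ψ 1 = 1 := by
    have : ‖ψ 1‖ = (ψ 1).re := by linarith
    have h5 := Complex.sq_norm (ψ 1)
    rw [Complex.normSq_apply, this, f1] at h5
    apply Complex.ext
    · simpa using f1
    · have : (ψ 1).im * (ψ 1).im = 0 := by linarith
      simpa using this
  -- On self-adjoint elements the Hermitian part of ψ equals Re ψ, so positivity of Re ψ becomes
  -- positivity in ℂ.
  have hself : ∀ x : A, star x = x →
      ((1 / 2 : ℂ) • (ψ + dualStar ψ)) x = (((ψ x).re : ℝ) : ℂ) := fun x hx => by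
    change (1 / 2 : ℂ) * (ψ x + star (ψ (star x))) = _
    rw [hx]
    change (1 / 2 : ℂ) * (ψ x + (starRingEnd ℂ) (ψ x)) = _
    rw [Complex.add_conj]; push_cast; ring
  refine ⟨⟨(1 / 2 : ℂ) • (ψ + dualStar ψ), fun a => ?_⟩, ?_, ?_⟩
  · rw [hself _ (by simp)]
    exact_mod_cast re_nonneg_of_norm_le_one hψ g1 a
  · refine (hself 1 (star_one A)).trans ?_
    rw [f1]; simp
  · refine (hself _ (by simp)).trans ?_
    rw [f2, CStarRing.norm_star_mul_self, sq]

theorem inner_self_eq_ofReal {H : Type u} [NormedAddCommGroup H] [InnerProductSpace ℂ H] (v : H) :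
    inner ℂ v v = ((‖v‖ ^ 2 : ℝ) : ℂ) := by
  rw [inner_self_eq_norm_sq_to_K]; simp

namespace PosFunctional

/-- A vector representation of a positive functional. -/
theorem exists_rep (f : PosFunctional A) :
    ∃ (π : Rep A) (ξ : π.H), ∀ a, f a = inner ℂ ξ (π.hom a ξ) := by
  let _ := CStarAlgebra.spectralOrder A
  have _ := CStarAlgebra.spectralOrderedRing A
  let g : A →ₚ[ℂ] ℂ := PositiveLinearMap.mk₀ f.toDual.toLinearMap fun x hx => by
    obtain ⟨w, rfl⟩ := CStarAlgebra.nonneg_iff_eq_star_mul_self.mp hx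
    exact f.nonneg w
  -- The vector is the class of 1 in the GNS space.
  refine ⟨⟨g.GNS, g.gnsStarAlgHom⟩, ((g.toPreGNS 1 : g.PreGNS) : g.GNS), fun a => ?_⟩
  change f a = inner ℂ _ (g.gnsNonUnitalStarAlgHom a _)
  rw [g.gnsNonUnitalStarAlgHom_apply_coe, Completion.inner_coe, PositiveLinearMap.preGNS_inner_def]
  simp
  rfl

theorem apply_star (f : PosFunctional A) (a : A) : f (star a) = star (f a) := by
  obtain ⟨π, ξ, h⟩ := f.exists_rep
  rw [h, h, map_star, ContinuousLinearMap.star_eq_adjoint,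
    ContinuousLinearMap.adjoint_inner_right]
  exact (inner_conj_symm _ _).symm

theorem norm_le (f : PosFunctional A) (a : A) : ‖f a‖ ≤ (f 1).re * ‖a‖ := by
  obtain ⟨π, ξ, h⟩ := f.exists_rep
  have h1 : (f 1).re = ‖ξ‖ * ‖ξ‖ := by
    rw [h, map_one, one_apply_eq_self, inner_self_eq_ofReal, Complex.ofReal_re, sq]
  rw [h1, h]
  refine (norm_inner_le_norm _ _).trans ?_
  rw [mul_assoc]
  refine mul_le_mul_of_nonneg_left ?_ (norm_nonneg _)
  refine ((π.hom a).le_opNorm ξ).trans ?_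
  rw [mul_comm]
  exact mul_le_mul_of_nonneg_left (NonUnitalStarAlgHom.norm_apply_le π.hom a) (norm_nonneg _)

end PosFunctional

/-- The Gelfand-Naimark theorem: the norm is the supremum over all representations. -/
theorem norm_le_sup_allReps (a : A) : ‖a‖ ≤ (allReps A).sup a := by
  rcases subsingleton_or_nontrivial A with hA | hA
  · rw [Subsingleton.elim a 0, norm_zero]; exact RepFamily.sup_nonneg _ _
  obtain ⟨f, h1, h2⟩ := exists_state a
  obtain ⟨π, ξ, h⟩ := f.exists_rep
  refine le_trans ?_ ((allReps A).le_sup a π)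
  change ‖a‖ ≤ ‖π.hom a‖
  have n1 : ‖ξ‖ = 1 := by
    rw [h, map_one, one_apply_eq_self, inner_self_eq_ofReal] at h1
    have : ‖ξ‖ ^ 2 = 1 := by exact_mod_cast h1
    exact (pow_eq_one_iff_of_nonneg (norm_nonneg _) two_ne_zero).mp this
  have n2 : ‖π.hom a ξ‖ = ‖a‖ := by
    rw [h, map_mul, map_star, mul_apply_eq_comp,
      ContinuousLinearMap.star_eq_adjoint, ContinuousLinearMap.adjoint_inner_right,
      inner_self_eq_ofReal] at h2
    have : ‖π.hom a ξ‖ ^ 2 = ‖a‖ ^ 2 := by exact_mod_cast h2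
    exact (pow_left_inj₀ (norm_nonneg _) (norm_nonneg _) two_ne_zero).mp this
  simpa [n1, n2] using (π.hom a).le_opNorm ξ

/-- Positive functionals separate the points. -/
theorem eq_zero_of_posFunctional {a : A} (h : ∀ f : PosFunctional A, f (star a * a) = 0) :
    a = 0 := by
  rcases subsingleton_or_nontrivial A with hA | hA
  · exact Subsingleton.elim _ _
  obtain ⟨f, -, h2⟩ := exists_state a
  rw [h f] at h2
  have : ‖a‖ ^ 2 = 0 := by exact_mod_cast h2.symm
  simpa using this

end

end PositiveFunctionals

/-! ### Slice maps on algebraic tensor products and their extension to completions -/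

noncomputable section Slice

variable {B C D : Type u} [Ring B] [Algebra ℂ B] [CStarAlgebra C]
  [NormedAddCommGroup D] [NormedSpace ℂ D]

/-- The slice map `b ⊗ c ↦ f(c) j(b)` on the algebraic tensor product. -/
def algSlice (j : B →ₗ[ℂ] D) (f : PosFunctional C) : B ⊗[ℂ] C →ₗ[ℂ] D :=
  (TensorProduct.rid ℂ D).toLinearMap ∘ₗ TensorProduct.map j f.toDual.toLinearMap

@[simp]
theorem algSlice_tmul (j : B →ₗ[ℂ] D) (f : PosFunctional C) (b : B) (c : C) :
    algSlice j f (b ⊗ₜ c) = f c • j b := by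
  simp [algSlice]

/-- The slice map on the algebraic tensor product, with values in the first factor. -/
def algSliceId (f : PosFunctional C) : B ⊗[ℂ] C →ₗ[ℂ] B :=
  (TensorProduct.rid ℂ B).toLinearMap ∘ₗ TensorProduct.map LinearMap.id f.toDual.toLinearMap

@[simp]
theorem algSliceId_tmul (f : PosFunctional C) (b : B) (c : C) :
    algSliceId f (b ⊗ₜ[ℂ] c) = f c • b := by
  simp [algSliceId]

/-- Reduces norm bounds for a slice with values in D to the one with values in B. Below, j is the
identity for ι ⊗ f and the map of A ⊗ B into its completion for ι ⊗ ι ⊗ f. -/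
theorem algSlice_eq (j : B →ₗ[ℂ] D) (f : PosFunctional C) (x : B ⊗[ℂ] C) :
    algSlice j f x = j (algSliceId f x) := by
  induction x with
  | zero => simp
  | add x y hx hy => rw [map_add, map_add, map_add, hx, hy]
  | tmul b c => simp

variable [StarRing B] [StarModule ℂ B]

theorem inner_prodHom {H K : Type u} [NormedAddCommGroup H] [InnerProductSpace ℂ H]
    [CompleteSpace H] [NormedAddCommGroup K] [InnerProductSpace ℂ K] [CompleteSpace K]
    (π : B →⋆ₐ[ℂ] (H →L[ℂ] H)) (ρ : C →⋆ₐ[ℂ] (K →L[ℂ] K)) {f : PosFunctional C} {ξ : K}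
    (hf : ∀ c, f c = inner ℂ ξ (ρ c ξ)) (v w : H) (x : B ⊗[ℂ] C) :
    inner ℂ (htOf H K (v ⊗ₜ ξ)) (prodHom π ρ x (htOf H K (w ⊗ₜ ξ))) =
      inner ℂ v (π (algSliceId f x) w) := by
  induction x with
  | zero => simp
  | add x y hx hy =>
    rw [map_add, map_add, map_add, _root_.add_apply, _root_.add_apply, inner_add_right,
      inner_add_right, hx, hy]
  | tmul b c =>
    rw [prodHom_tmul, opTensor_htOf, LinearIsometry.inner_map_map, TensorProduct.mapL_tmul,
      TensorProduct.inner_tmul, ← hf, algSliceId_tmul, map_smul, _root_.smul_apply,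
      inner_smul_right, mul_comm]

theorem norm_htOf_tmul {H K : Type u} [NormedAddCommGroup H] [InnerProductSpace ℂ H]
    [NormedAddCommGroup K] [InnerProductSpace ℂ K] (v : H) (ξ : K) :
    ‖htOf H K (v ⊗ₜ ξ)‖ = ‖v‖ * ‖ξ‖ := by
  rw [LinearIsometry.norm_map, TensorProduct.norm_tmul]

/-- If f is the vector functional of ξ under ρ, then π((ι ⊗ f)x) is the compression of (π ⊗ ρ)(x) to
vectors of the form w ⊗ ξ, so its norm is at most ‖ξ‖² = f(1) times that of (π ⊗ ρ)(x). -/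
theorem sup_algSliceId_le (F : RepFamily B) (f : PosFunctional C) (x : B ⊗[ℂ] C) :
    F.sup (algSliceId f x) ≤ (f 1).re * (F.prod (allReps C)).sup x := by
  obtain ⟨ρ, ξ, hf⟩ := f.exists_rep
  have h1 : (f 1).re = ‖ξ‖ * ‖ξ‖ := by
    rw [hf, map_one, one_apply_eq_self, inner_self_eq_ofReal, Complex.ofReal_re, sq]
  have h0 := RepFamily.sup_nonneg (F.prod (allReps C)) x
  have hM : 0 ≤ (f 1).re * (F.prod (allReps C)).sup x := by rw [h1]; positivity
  refine F.sup_le hM fun i => ContinuousLinearMap.opNorm_le_bound _ hM fun w => ?_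
  set T := (F.rep i).hom (algSliceId f x)
  -- With v = T w the matrix coefficient becomes ‖T w‖², and one factor ‖T w‖ cancels at the end.
  have key := inner_prodHom (F.rep i).hom ρ.hom hf (T w) w x
  have hb : ‖prodHom (F.rep i).hom ρ.hom x‖ ≤ (F.prod (allReps C)).sup x :=
    (F.prod (allReps C)).le_sup x (i, ρ)
  have h2 : ‖T w‖ * ‖T w‖ ≤ (‖T w‖ * ‖ξ‖) * ((F.prod (allReps C)).sup x * (‖w‖ * ‖ξ‖)) := by
    have e : ‖T w‖ * ‖T w‖ = ‖inner ℂ (T w) (T w)‖ := by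
      rw [inner_self_eq_ofReal, Complex.norm_real, Real.norm_of_nonneg (by positivity), sq]
    rw [e, ← key, ← norm_htOf_tmul, ← norm_htOf_tmul]
    refine (norm_inner_le_norm _ _).trans (mul_le_mul_of_nonneg_left ?_ (norm_nonneg _))
    exact (ContinuousLinearMap.le_opNorm _ _).trans
      (mul_le_mul_of_nonneg_right hb (norm_nonneg _))
  rcases (norm_nonneg (T w)).eq_or_lt with h | h
  · rw [← h]; positivity
  · refine le_of_mul_le_mul_left (h2.trans_eq ?_) h
    rw [h1]; ring

variable (F : RepFamily B)

/-- The slice map on the algebra with the seminorm of the family. -/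
def preSlice (j : B →ₗ[ℂ] D) (hj : ∀ b, ‖j b‖ ≤ F.sup b) (f : PosFunctional C) :
    (F.prod (allReps C)).Pre →L[ℂ] D :=
  LinearMap.mkContinuous
    { toFun x := algSlice j f ((F.prod (allReps C)).toPre.symm x)
      map_add' x y := by rw [map_add, map_add]
      map_smul' c x := by rw [map_smul, map_smul, RingHom.id_apply] } (f 1).re fun x => by
    exact (congrArg norm (algSlice_eq j f _)).trans_le
      ((hj _).trans (sup_algSliceId_le F f ((F.prod (allReps C)).toPre.symm x)))

variable [CompleteSpace D]

/-- The slice map `b ⊗ c ↦ f(c) j(b)` on the completed tensor product. -/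
def RepFamily.slice (j : B →ₗ[ℂ] D) (hj : ∀ b, ‖j b‖ ≤ F.sup b) (f : PosFunctional C) :
    (F.prod (allReps C)).Alg →L[ℂ] D :=
  (preSlice F j hj f).extend
    (Completion.toComplL (𝕜 := ℂ) (E := (F.prod (allReps C)).Pre))

theorem RepFamily.slice_of (j : B →ₗ[ℂ] D) (hj : ∀ b, ‖j b‖ ≤ F.sup b) (f : PosFunctional C)
    (x : B ⊗[ℂ] C) : F.slice j hj f ((F.prod (allReps C)).of x) = algSlice j f x :=
  ContinuousLinearMap.extend_eq (preSlice F j hj f)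
    (e := Completion.toComplL (𝕜 := ℂ) (E := (F.prod (allReps C)).Pre))
    (Completion.denseRange_coe) (Completion.isUniformInducing_coe _) _

end Slice

/-! ### Slice maps on spatial tensor products and positivity of product functionals -/

noncomputable section SpatialSlices

variable {A B C D : Type u} [CStarAlgebra A] [CStarAlgebra B] [CStarAlgebra C] [CStarAlgebra D]

/-- The slice map `ι ⊗ f : A ⊗ B → A`. -/
def slice (A : Type u) [CStarAlgebra A] (f : PosFunctional B) : Spatial A B →L[ℂ] A :=
  (allReps A).slice LinearMap.id norm_le_sup_allReps f

/-- The slice map `ι ⊗ ι ⊗ f : A ⊗ B ⊗ C → A ⊗ B`. -/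
def slice₃ (A B : Type u) [CStarAlgebra A] [CStarAlgebra B] (f : PosFunctional C) :
    Spatial₃ A B C →L[ℂ] Spatial A B :=
  ((allReps A).prod (allReps B)).slice (spatialOf A B).toAlgHom.toLinearMap
    (fun b => (RepFamily.norm_of _ b).le) f

theorem slice_spatialOf (f : PosFunctional B) (x : A ⊗[ℂ] B) :
    slice A f (spatialOf A B x) = algSliceId f x :=
  ((allReps A).slice_of _ _ f x).trans (algSlice_eq _ f x)

@[simp]
theorem slice_tens (f : PosFunctional B) (a : A) (b : B) : slice A f (tens a b) = f b • a :=
  (slice_spatialOf f _).trans (algSliceId_tmul f a b)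

theorem slice₃_spatialOf₃ (f : PosFunctional C) (x : A ⊗[ℂ] B) (c : C) :
    slice₃ A B f (spatialOf₃ A B C (x ⊗ₜ c)) = f c • spatialOf A B x :=
  (RepFamily.slice_of _ _ _ f _).trans (algSlice_tmul _ f _ _)

theorem continuous_tens_left (b : B) : Continuous fun a : A => tens a b := by
  have : (fun a : A => tens a b) = fun a => spatialLeft A B a * spatialRight A B b := by
    funext a
    refine Eq.trans ?_ (map_mul (spatialOf A B) _ _)
    change _ = spatialOf A B ((a ⊗ₜ[ℂ] (1 : B)) * ((1 : A) ⊗ₜ[ℂ] b))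
    rw [Algebra.TensorProduct.tmul_mul_tmul, one_mul, mul_one]; rfl
  rw [this]
  exact (continuous_hom _).mul continuous_const

theorem tens_mul_tens (a a' : A) (b b' : B) :
    tens a b * tens a' b' = tens (a * a') (b * b') := by
  refine (map_mul (spatialOf A B) _ _).symm.trans ?_
  rw [Algebra.TensorProduct.tmul_mul_tmul]; rfl

theorem star_tens (a : A) (b : B) : star (tens a b) = tens (star a) (star b) := by
  refine (map_star (spatialOf A B) _).symm.trans ?_
  rw [TensorProduct.star_tmul]; rfl

theorem tens_one_one : tens (1 : A) (1 : B) = 1 := map_one (spatialOf A B)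

/-- A closed additive property of the elementary tensors holds for all elements. -/
theorem spatial_induction {p : Spatial A B → Prop} (hp : IsClosed {x | p x})
    (h0 : p 0) (hadd : ∀ x y, p x → p y → p (x + y)) (ht : ∀ a b, p (tens a b))
    (x : Spatial A B) : p x := by
  refine RepFamily.induction _ hp (fun t => ?_) x
  change p (spatialOf A B t)
  induction t with
  | zero => rwa [map_zero]
  | add x y hx hy => rw [map_add]; exact hadd _ _ hx hy
  | tmul a b => exact ht a b

theorem clm_ext_tens {E : Type u} [NormedAddCommGroup E] [NormedSpace ℂ E]
    {S T : Spatial A B →L[ℂ] E} (h : ∀ a b, S (tens a b) = T (tens a b)) : S = T := by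
  ext x
  refine spatial_induction (p := fun x => S x = T x) (isClosed_eq S.continuous T.continuous)
    ?_ (fun x y hx hy => ?_) h x
  · rw [map_zero, map_zero]
  · rw [map_add, map_add, hx, hy]

/-- A unital `*`-homomorphism as a continuous linear map. -/
def homL (φ : D →⋆ₐ[ℂ] B) : D →L[ℂ] B := ⟨φ.toAlgHom.toLinearMap, continuous_hom φ⟩

@[simp] theorem homL_apply (φ : D →⋆ₐ[ℂ] B) (x : D) : homL φ x = φ x := rfl

theorem slice₃_leg₁₂_mul_leg₃ (f : PosFunctional C) (x : Spatial A B) (c : C) :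
    slice₃ A B f (leg₁₂ A B C x * leg₃ A B C c) = f c • x := by
  refine spatial_induction (p := fun x => slice₃ A B f (leg₁₂ A B C x * leg₃ A B C c) = f c • x)
    (isClosed_eq ((slice₃ A B f).continuous.comp ((continuous_hom _).mul continuous_const))
      (continuous_const_smul _)) ?_ (fun x y hx hy => ?_) (fun a b => ?_) x
  · rw [map_zero, zero_mul, map_zero, smul_zero]
  · rw [map_add, add_mul, map_add, hx, hy, smul_add]
  · have : leg₁₂ A B C (tens a b) * leg₃ A B C c = spatialOf₃ A B C ((a ⊗ₜ b) ⊗ₜ c) := by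
      refine (congrArg (· * _) (leg₁₂_of (a ⊗ₜ b))).trans
        ((map_mul (spatialOf₃ A B C) _ _).symm.trans ?_)
      change spatialOf₃ A B C (((a ⊗ₜ b) ⊗ₜ (1 : C)) * ((1 : A ⊗[ℂ] B) ⊗ₜ[ℂ] c)) = _
      rw [Algebra.TensorProduct.tmul_mul_tmul, mul_one, one_mul]
    rw [this, slice₃_spatialOf₃]; rfl

theorem slice₃_leg₁_mul_leg₂₃ (f : PosFunctional C) (a : A) (x : Spatial B C) :
    slice₃ A B f (leg₁ A B C a * leg₂₃ A B C x) =
      spatialLeft A B a * spatialRight A B (slice B f x) := by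
  refine spatial_induction (p := fun x => slice₃ A B f (leg₁ A B C a * leg₂₃ A B C x) =
      spatialLeft A B a * spatialRight A B (slice B f x))
    (isClosed_eq ((slice₃ A B f).continuous.comp (continuous_const.mul (continuous_hom _)))
      (continuous_const.mul ((continuous_hom _).comp (slice B f).continuous)))
    ?_ (fun x y hx hy => ?_) (fun b c => ?_) x
  · simp only [map_zero, mul_zero]
  · simp only [map_add, mul_add, hx, hy]
  · have : leg₁ A B C a * leg₂₃ A B C (tens b c) = spatialOf₃ A B C ((a ⊗ₜ b) ⊗ₜ c) := by
      refine (congrArg (_ * ·) (leg₂₃_of (b ⊗ₜ c))).trans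
        ((map_mul (spatialOf₃ A B C) _ _).symm.trans ?_)
      change spatialOf₃ A B C (((a ⊗ₜ[ℂ] (1 : B)) ⊗ₜ (1 : C)) * algLeg₂₃ A B C (b ⊗ₜ[ℂ] c)) = _
      rw [algLeg₂₃_tmul]
      simp only [Algebra.TensorProduct.tmul_mul_tmul, mul_one, one_mul]
    rw [this, slice₃_spatialOf₃, slice_tens, map_smul, mul_smul_comm]
    refine congrArg (f c • ·) ?_
    change _ = tens a 1 * tens 1 b
    rw [tens_mul_tens, one_mul, mul_one]; rfl

/-- `(ι ⊗ ι ⊗ f)(φ ⊗ ι) = φ (ι ⊗ f)`. -/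
theorem slice₃_tensorId (f : PosFunctional C) (φ : D →⋆ₐ[ℂ] Spatial A B) (x : Spatial D C) :
    slice₃ A B f (tensorId φ C x) = φ (slice D f x) := by
  have : (slice₃ A B f).comp (homL (tensorId φ C)) = (homL φ).comp (slice D f) :=
    clm_ext_tens fun d c => by
      simp only [ContinuousLinearMap.comp_apply, homL_apply]
      rw [tensorId_tens, slice₃_leg₁₂_mul_leg₃, slice_tens, map_smul]
  exact congrArg (fun T => T x) this

theorem slice₃_idTensor_tens (f : PosFunctional C) (ψ : D →⋆ₐ[ℂ] Spatial B C) (a : A) (d : D) :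
    slice₃ A B f (idTensor A ψ (tens a d)) = tens a (slice B f (ψ d)) := by
  rw [idTensor_tens, slice₃_leg₁_mul_leg₂₃]
  change tens a 1 * tens 1 _ = _
  rw [tens_mul_tens, mul_one, one_mul]

/-- The vector functional of the product representation is the composition of the slice map with
the vector functional of the first factor. -/
theorem inner_spatialRep {f : PosFunctional A} {g : PosFunctional B} {π : Rep A} {η : π.H}
    {ρ : Rep B} {ξ : ρ.H} (hf : ∀ a, f a = inner ℂ η (π.hom a η))
    (hg : ∀ b, g b = inner ℂ ξ (ρ.hom b ξ)) (x : Spatial A B) :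
    inner ℂ (htOf π.H ρ.H (η ⊗ₜ ξ)) (spatialRep π.hom ρ.hom x (htOf π.H ρ.H (η ⊗ₜ ξ))) =
      f (slice A g x) := by
  refine RepFamily.induction _ (p := fun x => inner ℂ (htOf π.H ρ.H (η ⊗ₜ ξ))
    (spatialRep π.hom ρ.hom x (htOf π.H ρ.H (η ⊗ₜ ξ))) = f (slice A g x)) (isClosed_eq
      (continuous_const.inner ((continuous_hom (spatialRep π.hom ρ.hom)).clm_apply
        continuous_const)) (f.toDual.continuous.comp (slice A g).continuous)) (fun t => ?_) x
  change inner ℂ _ (spatialRep π.hom ρ.hom (spatialOf A B t) _) = f (slice A g (spatialOf A B t))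
  rw [spatialRep_of, slice_spatialOf, hf, inner_prodHom π.hom ρ.hom hg]

-- The functional f ⊗ g is the vector functional of η ⊗ ξ under π ⊗ ρ, so its value at x*x is a
-- squared norm.
open scoped ComplexOrder in
theorem nonneg_slice_star_mul_self (f : PosFunctional A) (g : PosFunctional B) (x : Spatial A B) :
    0 ≤ f (slice A g (star x * x)) := by
  obtain ⟨π, η, hf⟩ := f.exists_rep
  obtain ⟨ρ, ξ, hg⟩ := g.exists_rep
  rw [← inner_spatialRep hf hg, map_mul, map_star, mul_apply_eq_comp,
    ContinuousLinearMap.star_eq_adjoint, ContinuousLinearMap.adjoint_inner_right,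
    inner_self_eq_ofReal]
  exact Complex.zero_le_real.mpr (sq_nonneg _)

/-- The Cauchy-Schwarz inequality in its degenerate form. -/
theorem slice_mul_eq_zero {f : PosFunctional A} {g : PosFunctional B} {x : Spatial A B}
    (h : f (slice A g (star x * x)) = 0) (y : Spatial A B) : f (slice A g (y * x)) = 0 := by
  obtain ⟨π, η, hf⟩ := f.exists_rep
  obtain ⟨ρ, ξ, hg⟩ := g.exists_rep
  rw [← inner_spatialRep hf hg, map_mul, mul_apply_eq_comp] at h ⊢
  rw [map_star, ContinuousLinearMap.star_eq_adjoint, ContinuousLinearMap.adjoint_inner_right,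
    inner_self_eq_zero] at h
  rw [h, map_zero, inner_zero_right]

theorem slice_star (f : PosFunctional B) (x : Spatial A B) :
    slice A f (star x) = star (slice A f x) := by
  refine spatial_induction (p := fun x => slice A f (star x) = star (slice A f x))
    (isClosed_eq ((slice A f).continuous.comp continuous_star)
      (continuous_star.comp (slice A f).continuous)) ?_ (fun x y hx hy => ?_) (fun a b => ?_) x
  · simp only [star_zero, map_zero]
  · simp only [star_add, map_add, hx, hy]
  · rw [star_tens, slice_tens, slice_tens, star_smul, f.apply_star]

theorem slice_tens_one_mul (f : PosFunctional B) (a : A) (x : Spatial A B) :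
    slice A f (tens a 1 * x) = a * slice A f x := by
  refine spatial_induction (p := fun x => slice A f (tens a 1 * x) = a * slice A f x)
    (isClosed_eq ((slice A f).continuous.comp (continuous_const.mul continuous_id))
      (continuous_const.mul (slice A f).continuous)) ?_ (fun x y hx hy => ?_) (fun a' b => ?_) x
  · simp only [mul_zero, map_zero]
  · simp only [mul_add, map_add, hx, hy]
  · rw [tens_mul_tens, one_mul, slice_tens, slice_tens, mul_smul_comm]

/-- Follows from the left-handed version by taking adjoints, since a positive functional is
Hermitian. -/
theorem slice_mul_tens_one (f : PosFunctional B) (a : A) (x : Spatial A B) :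
    slice A f (x * tens a 1) = slice A f x * a := by
  have h := slice_tens_one_mul f (star a) (star x)
  rw [slice_star] at h
  rw [← star_inj, star_mul, ← h, ← slice_star, star_mul, star_tens, star_one]

end SpatialSlices

/-! ### Limits of states, convolution and the Haar state -/

noncomputable section HaarState

open Filter Topology
open scoped ComplexOrder

variable {A C : Type u} [CStarAlgebra A] [CStarAlgebra C]

theorem norm_slice_le (f : PosFunctional A) (x : Spatial C A) :
    ‖slice C f x‖ ≤ (f 1).re * ‖x‖ := by
  refine RepFamily.induction _ (p := fun x => ‖slice C f x‖ ≤ (f 1).re * ‖x‖)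
    (isClosed_le (slice C f).continuous.norm (continuous_const.mul continuous_norm))
    (fun t => ?_) x
  rw [RepFamily.norm_coe]
  refine (congrArg norm (slice_spatialOf f t)).trans_le ?_
  exact (norm_le_sup_allReps _).trans (sup_algSliceId_le (allReps C) f t)

namespace PosFunctional

/-- The vector functional of a representation. -/
def ofVec (π : Rep A) (v : π.H) : PosFunctional A where
  toDual := (innerSL ℂ v).comp ((ContinuousLinearMap.apply ℂ π.H v).comp
    (homL (B := π.H →L[ℂ] π.H) π.hom))
  nonneg a := by
    change 0 ≤ inner ℂ v (π.hom (star a * a) v)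
    rw [map_mul, map_star, mul_apply_eq_comp,
      ContinuousLinearMap.star_eq_adjoint, ContinuousLinearMap.adjoint_inner_right,
      inner_self_eq_ofReal]
    exact Complex.zero_le_real.mpr (sq_nonneg _)

/-- In each representation all vector functionals vanish at x, so by complex polarization x acts as
0; the norm formula over all representations finishes. -/
theorem separating {x : A} (h : ∀ f : PosFunctional A, f x = 0) : x = 0 := by
  have h0 : ‖x‖ ≤ 0 := (norm_le_sup_allReps x).trans <|
    RepFamily.sup_le _ le_rfl fun (π : Rep A) => by
    have : ((π.hom x : π.H →L[ℂ] π.H) : π.H →ₗ[ℂ] π.H) = 0 := by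
      refine (inner_map_self_eq_zero _).mp fun v => ?_
      rw [← inner_conj_symm]
      have := h (ofVec π v)
      exact (congrArg (starRingEnd ℂ) this).trans (map_zero _)
    have h2 : π.hom x = 0 := ContinuousLinearMap.coe_injective this
    change ‖π.hom x‖ ≤ 0
    rw [h2, norm_zero]
  simpa using h0

theorem one_nonneg (f : PosFunctional A) : 0 ≤ f 1 := by
  simpa using f.nonneg 1

/-- The sum of two positive functionals. -/
def add (f g : PosFunctional A) : PosFunctional A where
  toDual := f.toDual + g.toDual
  nonneg a := add_nonneg (f.nonneg a) (g.nonneg a)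

/-- A nonnegative multiple of a positive functional. -/
def smul (r : ℝ) (hr : 0 ≤ r) (f : PosFunctional A) : PosFunctional A where
  toDual := (r : ℂ) • f.toDual
  nonneg a := mul_nonneg (Complex.zero_le_real.mpr hr) (f.nonneg a)

/-- The average of the first `n + 1` functionals of a sequence. -/
def average (f : ℕ → PosFunctional A) (n : ℕ) : PosFunctional A where
  toDual := (((n + 1 : ℝ)⁻¹ : ℝ) : ℂ) • ∑ k ∈ Finset.range (n + 1), (f k).toDual
  nonneg a := by
    rw [_root_.smul_apply, sum_apply]
    exact mul_nonneg (Complex.zero_le_real.mpr (by positivity))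
      (Finset.sum_nonneg fun k _ => (f k).nonneg a)

theorem average_apply (f : ℕ → PosFunctional A) (n : ℕ) (a : A) :
    average f n a = (((n + 1 : ℝ)⁻¹ : ℝ) : ℂ) * ∑ k ∈ Finset.range (n + 1), f k a := by
  change ((((n + 1 : ℝ)⁻¹ : ℝ) : ℂ) • ∑ k ∈ Finset.range (n + 1), (f k).toDual) a = _
  rw [_root_.smul_apply, sum_apply, smul_eq_mul]

/-- Banach-Alaoglu: states lie in the unit ball of the dual, and positivity and the value at 1
survive pointwise limits. -/
theorem exists_ultrafilter_limit {ι : Type*} (U : Ultrafilter ι) (f : ι → PosFunctional A)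
    (hf : ∀ i, f i 1 = 1) :
    ∃ h : PosFunctional A, h 1 = 1 ∧ ∀ a, Tendsto (fun i => f i a) U (𝓝 (h a)) := by
  have hc := WeakDual.isCompact_closedBall (𝕜 := ℂ) (E := A) 0 1
  obtain ⟨φ, -, hφ⟩ := hc.ultrafilter_le_nhds
    (U.map fun i => StrongDual.toWeakDual (f i).toDual) (by
      rw [le_principal_iff]
      refine Filter.mem_map.mpr (Eventually.of_forall fun i => ?_)
      refine mem_closedBall_zero_iff.mpr (ContinuousLinearMap.opNorm_le_bound _ zero_le_one
        fun a => ?_)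
      have := (f i).norm_le a
      rwa [hf, Complex.one_re] at this)
  have ht : ∀ a, Tendsto (fun i => f i a) U (𝓝 (φ a)) := fun a =>
    ((WeakDual.eval_continuous a).tendsto φ).comp (show Tendsto _ (U : Filter ι) (𝓝 φ) from hφ)
  refine ⟨⟨WeakDual.toStrongDual φ, fun a =>
    ge_of_tendsto' (ht (star a * a)) fun i => (f i).nonneg a⟩, ?_, ht⟩
  exact tendsto_nhds_unique (ht 1) (by simp only [hf]; exact tendsto_const_nhds)

/-- Slices by states are contractions, hence equicontinuous, so the set of points of convergence is
closed and only elementary tensors need to be checked. -/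
theorem tendsto_slice {ι : Type*} {U : Filter ι} {f : ι → PosFunctional A} {h : PosFunctional A}
    (hf : ∀ i, f i 1 = 1) (ht : ∀ a, Tendsto (fun i => f i a) U (𝓝 (h a)))
    (x : Spatial C A) : Tendsto (fun i => slice C (f i) x) U (𝓝 (slice C h x)) := by
  have he : Equicontinuous fun i x => slice C (f i) x :=
    (LipschitzWith.uniformEquicontinuous _ 1 fun i =>
      AddMonoidHomClass.lipschitz_of_bound_nnnorm (slice C (f i)) 1 fun x => by
        have := norm_slice_le (f i) x
        rw [hf, Complex.one_re] at this
        exact_mod_cast this).equicontinuous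
  refine spatial_induction (p := fun x => Tendsto (fun i => slice C (f i) x) U (𝓝 (slice C h x)))
    (he.isClosed_setOfPred_tendsto (slice C h).continuous) ?_ (fun x y hx hy => ?_)
    (fun c a => ?_) x
  · simp only [map_zero]; exact tendsto_const_nhds
  · simp only [map_add]; exact hx.add hy
  · simp only [slice_tens]; exact (ht a).smul_const c

end PosFunctional

theorem slice_average (f : ℕ → PosFunctional A) (n : ℕ) (x : Spatial C A) :
    slice C (PosFunctional.average f n) x =
      (((n + 1 : ℝ)⁻¹ : ℝ) : ℂ) • ∑ k ∈ Finset.range (n + 1), slice C (f k) x := by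
  have : slice C (PosFunctional.average f n) =
      (((n + 1 : ℝ)⁻¹ : ℝ) : ℂ) • ∑ k ∈ Finset.range (n + 1), slice C (f k) :=
    clm_ext_tens fun c a => by
      rw [_root_.smul_apply, sum_apply]
      simp only [slice_tens]
      rw [PosFunctional.average_apply, mul_smul, Finset.sum_smul]
  rw [this, _root_.smul_apply, sum_apply]

/-- Slice maps are linear in the functional. -/
theorem slice_of_eq_add {f g k : PosFunctional A} (h : ∀ a, f a = g a + k a) (x : Spatial C A) :
    slice C f x = slice C g x + slice C k x := by
  have : slice C f = slice C g + slice C k := clm_ext_tens fun c a => by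
    rw [_root_.add_apply, slice_tens, slice_tens, slice_tens, h, add_smul]
  rw [this, _root_.add_apply]

theorem slice_of_eq_mul {f g : PosFunctional A} {r : ℂ} (h : ∀ a, f a = r * g a)
    (x : Spatial C A) : slice C f x = r • slice C g x := by
  have : slice C f = r • slice C g := clm_ext_tens fun c a => by
    rw [_root_.smul_apply, slice_tens, slice_tens, h, mul_smul]
  rw [this, _root_.smul_apply]

namespace CompactQuantumGroup

variable (G : CompactQuantumGroup A)

/-- The convolution `f * g = (f ⊗ g)Δ` of positive functionals. -/
def conv (f g : PosFunctional A) : PosFunctional A where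
  toDual := f.toDual.comp ((slice A g).comp (homL G.comul))
  nonneg a := by
    change 0 ≤ f (slice A g (G.comul (star a * a)))
    rw [map_mul, map_star]
    exact nonneg_slice_star_mul_self f g _

theorem conv_apply (f g : PosFunctional A) (a : A) :
    G.conv f g a = f (slice A g (G.comul a)) := rfl

/-- `(ι ⊗ f)(ι ⊗ ι ⊗ g)(ι ⊗ Δ) = ι ⊗ (f * g)`. -/
theorem slice_slice₃_idTensor (f g : PosFunctional A) (x : Spatial C A) :
    slice C f (slice₃ C A g (idTensor C G.comul x)) = slice C (G.conv f g) x := by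
  have : (slice C f).comp ((slice₃ C A g).comp (homL (idTensor C G.comul))) =
      slice C (G.conv f g) := clm_ext_tens fun c a => by
    simp only [ContinuousLinearMap.comp_apply, homL_apply]
    rw [slice₃_idTensor_tens, slice_tens, slice_tens, conv_apply]
  exact congrArg (fun T => T x) this

/-- Coassociativity of Δ in functional form; associativity of convolution and the invariance
arguments rest on it. -/
theorem slice_comul_slice_comul (f g : PosFunctional A) (a : A) :
    slice A f (G.comul (slice A g (G.comul a))) = slice A (G.conv f g) (G.comul a) := by
  rw [← slice₃_tensorId, G.coassoc, slice_slice₃_idTensor]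

theorem conv_assoc (f g h : PosFunctional A) (a : A) :
    G.conv (G.conv f g) h a = G.conv f (G.conv g h) a := by
  rw [conv_apply, conv_apply, conv_apply, slice_comul_slice_comul]

theorem eq_of_dense_left {E : Type*} [NormedAddCommGroup E] [NormedSpace ℂ E]
    {S T : Spatial A A →L[ℂ] E} (h : ∀ b c, S (tens b 1 * G.comul c) = T (tens b 1 * G.comul c)) :
    S = T := by
  refine ContinuousLinearMap.ext_on
    ((Submodule.dense_iff_topologicalClosure_eq_top).mpr G.dense_left) ?_
  rintro _ ⟨b, c, rfl⟩
  exact h b c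

/-- If a state is invariant under convolution with `f`, it is invariant under convolution from the
left with every positive functional dominated by `f`. -/
theorem conv_eq_of_dominated {f g k h : PosFunctional A} (hf : ∀ a, f a = g a + k a)
    (h1 : h 1 = 1) (hl : ∀ a, G.conv f h a = f 1 * h a) (hr : ∀ a, G.conv h f a = f 1 * h a)
    (a : A) : G.conv g h a = g 1 * h a := by
  have key : ∀ d a, h (slice A (G.conv g h) (tens d 1 * G.comul a)) =
      g 1 * h (slice A h (tens d 1 * G.comul a)) := by
    intro d a
    set b := slice A h (G.comul a) with hb
    have e1 : slice A f (G.comul b) = f 1 • b := by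
      rw [hb, slice_comul_slice_comul, slice_of_eq_mul hl]
    -- y measures how far b is from being invariant. Expanding y*y into four terms and applying h ⊗
    -- f, each term equals f(1)h(b*b) up to sign: the first by h * f = f(1)h, the next two by (ι ⊗
    -- f)Δ(b) = f(1)b. The signs cancel.
    set y := G.comul b - tens b 1 with hy
    have e2 : h (slice A f (star y * y)) = 0 := by
      have e3 : star y * y = G.comul (star b * b) - star (G.comul b) * tens b 1 -
          tens (star b) 1 * G.comul b + tens (star b) 1 * tens b 1 := by
        rw [hy, star_sub, star_tens, star_one, map_mul, map_star]; noncomm_ring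
      have e4 : h (slice A f (G.comul (star b * b))) = f 1 * h (star b * b) := hr _
      have e5 : star (f 1) = f 1 := by rw [← f.apply_star, star_one]
      rw [e3, map_add, map_sub, map_sub, slice_mul_tens_one, slice_tens_one_mul,
        slice_tens_one_mul, slice_star, e1, slice_tens, star_smul, e5, map_add, map_sub, map_sub,
        e4, smul_mul_assoc, mul_smul_comm, map_smul, smul_eq_mul]
      ring
    -- Since f = g + k and both contributions are nonnegative, each vanishes. This is where
    -- domination is used.
    have e6 : h (slice A g (star y * y)) = 0 := by
      rw [slice_of_eq_add hf, map_add] at e2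
      exact ((add_eq_zero_iff_of_nonneg (nonneg_slice_star_mul_self h g y)
        (nonneg_slice_star_mul_self h k y)).mp e2).1
    -- Cauchy-Schwarz turns the vanishing at y*y into a linear identity at (d ⊗ 1)y.
    have e7 := slice_mul_eq_zero e6 (tens d 1)
    rw [hy, mul_sub, map_sub, map_sub, slice_tens_one_mul, slice_tens_one_mul, slice_tens,
      sub_eq_zero, mul_smul_comm, map_smul, smul_eq_mul, hb, slice_comul_slice_comul] at e7
    rw [slice_tens_one_mul, slice_tens_one_mul, e7]
  -- Density of (A ⊗ I)Δ(A) replaces (d ⊗ 1)Δ(a) by arbitrary elements of A ⊗ A; evaluation at 1 ⊗ a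
  -- then removes the outer h.
  have h2 : h.toDual.comp (slice A (G.conv g h)) = g 1 • h.toDual.comp (slice A h) :=
    G.eq_of_dense_left key
  have h3 := congrArg (fun T => T (tens (1 : A) a)) h2
  simp only [ContinuousLinearMap.comp_apply, _root_.smul_apply, slice_tens, map_smul, h1,
    smul_eq_mul, mul_one] at h3
  exact h3

/-- The convolution powers `f, f * f, f * (f * f), …`. -/
def convPow (f : PosFunctional A) : ℕ → PosFunctional A
  | 0 => f
  | n + 1 => G.conv f (convPow f n)

theorem convPow_conv (f : PosFunctional A) (n : ℕ) (a : A) :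
    G.conv (G.convPow f n) f a = G.convPow f (n + 1) a := by
  induction n generalizing a with
  | zero => rfl
  | succ n ih =>
    change G.conv (G.conv f (G.convPow f n)) f a = G.conv f (G.convPow f (n + 1)) a
    rw [conv_assoc, conv_apply, conv_apply]
    congr 1
    have := slice_of_eq_mul (r := 1) (fun a => (ih a).trans (one_mul _).symm) (G.comul a)
    rwa [one_smul] at this

theorem convPow_one {f : PosFunctional A} (hf : f 1 = 1) (n : ℕ) : G.convPow f n 1 = 1 := by
  induction n with
  | zero => exact hf
  | succ n ih =>
    change f (slice A (G.convPow f n) (G.comul 1)) = 1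
    rw [map_one, ← tens_one_one, slice_tens, ih, one_smul, hf]

theorem norm_convPow_le {f : PosFunctional A} (hf : f 1 = 1) (n : ℕ) (a : A) :
    ‖G.convPow f n a‖ ≤ ‖a‖ := by
  have := (G.convPow f n).norm_le a
  rwa [G.convPow_one hf, Complex.one_re, one_mul] at this

/-- An ultrafilter limit of Cesàro means of the convolution powers of f. Convolving with f on either
side shifts the powers by one, which changes the means by a telescoping amount tending to 0. -/
theorem exists_invariant_of_state {f : PosFunctional A} (hf : f 1 = 1) :
    ∃ h : PosFunctional A, h 1 = 1 ∧ (∀ a, G.conv f h a = h a) ∧ ∀ a, G.conv h f a = h a := by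
  set M := PosFunctional.average (G.convPow f)
  set U := Ultrafilter.of (atTop : Filter ℕ)
  have hM1 : ∀ n, M n 1 = 1 := fun n => by
    rw [PosFunctional.average_apply]
    simp only [G.convPow_one hf, Finset.sum_const, Finset.card_range, nsmul_eq_mul, mul_one]
    push_cast
    exact inv_mul_cancel₀ (by exact_mod_cast n.succ_ne_zero)
  obtain ⟨h, h1, ht⟩ := PosFunctional.exists_ultrafilter_limit U M hM1
  have hs : ∀ a, Tendsto (fun n : ℕ => (((n + 1 : ℝ)⁻¹ : ℝ) : ℂ) *
      ∑ k ∈ Finset.range (n + 1), G.convPow f (k + 1) a) U (𝓝 (h a)) := fun a => by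
    -- The difference telescopes to two terms of norm at most ‖a‖, divided by n + 1.
    have hd : Tendsto (fun n : ℕ => (((n + 1 : ℝ)⁻¹ : ℝ) : ℂ) *
        ∑ k ∈ Finset.range (n + 1), G.convPow f (k + 1) a - M n a) atTop (𝓝 0) := by
      have hb : Tendsto (fun n : ℕ => (n + 1 : ℝ)⁻¹ * (‖a‖ + ‖a‖)) atTop (𝓝 0) := by
        simpa [one_div] using (tendsto_one_div_add_atTop_nhds_zero_nat (𝕜 := ℝ)).mul_const
          (‖a‖ + ‖a‖)
      refine squeeze_zero_norm (fun n => ?_) hb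
      rw [PosFunctional.average_apply, ← mul_sub, ← Finset.sum_sub_distrib,
        Finset.sum_range_sub (fun k => G.convPow f k a), norm_mul, Complex.norm_real,
        Real.norm_of_nonneg (by positivity)]
      exact mul_le_mul_of_nonneg_left ((norm_sub_le _ _).trans
        (add_le_add (G.norm_convPow_le hf _ a) (G.norm_convPow_le hf _ a))) (by positivity)
    have := (hd.mono_left (Ultrafilter.of_le _)).add (ht a)
    simpa using this
  refine ⟨h, h1, fun a => ?_, fun a => ?_⟩
  · have e : ∀ n, f (slice A (M n) (G.comul a)) = (((n + 1 : ℝ)⁻¹ : ℝ) : ℂ) *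
        ∑ k ∈ Finset.range (n + 1), G.convPow f (k + 1) a := fun n => by
      rw [slice_average, map_smul, map_sum, smul_eq_mul]; rfl
    refine tendsto_nhds_unique ?_ (hs a)
    simp only [← e]
    exact (f.toDual.continuous.tendsto _).comp (PosFunctional.tendsto_slice hM1 ht (G.comul a))
  · have e : ∀ n, M n (slice A f (G.comul a)) = (((n + 1 : ℝ)⁻¹ : ℝ) : ℂ) *
        ∑ k ∈ Finset.range (n + 1), G.convPow f (k + 1) a := fun n => by
      rw [PosFunctional.average_apply]
      simp only [← G.convPow_conv, conv_apply]
    refine tendsto_nhds_unique ?_ (hs a)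
    simp only [← e]
    exact ht _

theorem exists_invariant {f : PosFunctional A} (hf : 0 < f 1) :
    ∃ h : PosFunctional A, h 1 = 1 ∧ (∀ a, G.conv f h a = f 1 * h a) ∧
      ∀ a, G.conv h f a = f 1 * h a := by
  have hre : f 1 = (((f 1).re : ℝ) : ℂ) := Complex.ext rfl ((Complex.pos_iff.mp hf).2.symm)
  have hpos : 0 < (f 1).re := (Complex.pos_iff.mp hf).1
  set g := PosFunctional.smul (f 1).re⁻¹ (inv_nonneg.mpr hpos.le) f
  have hg : ∀ a, f a = f 1 * g a := fun a => by
    change f a = f 1 * ((((f 1).re⁻¹ : ℝ) : ℂ) * f a)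
    rw [Complex.ofReal_inv, ← hre, mul_inv_cancel_left₀ hf.ne']
  have hg1 : g 1 = 1 := mul_left_cancel₀ hf.ne' ((hg 1).symm.trans (mul_one _).symm)
  obtain ⟨h, h1, hl, hr⟩ := G.exists_invariant_of_state hg1
  refine ⟨h, h1, fun a => ?_, fun a => ?_⟩
  · rw [conv_apply, hg, ← conv_apply, hl]
  · rw [conv_apply, slice_of_eq_mul hg, map_smul, ← conv_apply, hr, smul_eq_mul]

/-- The sum of the family and one auxiliary state; the state makes the value at 1 positive even for
the empty family. -/
theorem exists_dominating [Nontrivial A] (F : Finset (PosFunctional A)) :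
    ∃ f : PosFunctional A, 0 < f 1 ∧ ∀ g ∈ F, ∃ k : PosFunctional A, ∀ a, f a = g a + k a := by
  classical
  induction F using Finset.induction_on with
  | empty =>
    obtain ⟨f, hf, -⟩ := exists_state (0 : A)
    exact ⟨f, by rw [hf]; exact one_pos, by simp⟩
  | insert g F _ ih =>
    obtain ⟨f, hf, h⟩ := ih
    refine ⟨f.add g, add_pos_of_pos_of_nonneg hf g.one_nonneg, fun g' hg' => ?_⟩
    rcases Finset.mem_insert.mp hg' with rfl | hg'
    · exact ⟨f, fun a => add_comm (f a) (g' a)⟩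
    · obtain ⟨k, hk⟩ := h g' hg'
      refine ⟨k.add g, fun a => ?_⟩
      change f a + g a = g' a + (k a + g a)
      rw [hk, add_assoc]

/-- Existence of the Haar state. -/
theorem exists_haar [Nontrivial A] :
    ∃ h : PosFunctional A, h 1 = 1 ∧ ∀ a, slice A h (G.comul a) = h a • (1 : A) := by
  -- A state invariant for one dominating functional is left-invariant for the whole finite family.
  -- A limit over the directed set of finite families handles all positive functionals, which
  -- separate points.
  have hF : ∀ F : Finset (PosFunctional A), ∃ h : PosFunctional A, h 1 = 1 ∧
      ∀ g ∈ F, ∀ a, G.conv g h a = g 1 * h a := fun F => by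
    obtain ⟨f, hf, hd⟩ := exists_dominating F
    obtain ⟨h, h1, hl, hr⟩ := G.exists_invariant hf
    refine ⟨h, h1, fun g hg a => ?_⟩
    obtain ⟨k, hk⟩ := hd g hg
    exact G.conv_eq_of_dominated hk h1 hl hr a
  choose φ h1 hφ using hF
  set U := Ultrafilter.of (atTop : Filter (Finset (PosFunctional A)))
  obtain ⟨h, hh, ht⟩ := PosFunctional.exists_ultrafilter_limit U φ h1
  refine ⟨h, hh, fun a => sub_eq_zero.mp (PosFunctional.separating fun g => ?_)⟩
  rw [map_sub, map_smul, sub_eq_zero, smul_eq_mul, mul_comm]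
  have t1 : Tendsto (fun F => g (slice A (φ F) (G.comul a))) U
      (𝓝 (g (slice A h (G.comul a)))) :=
    (g.toDual.continuous.tendsto _).comp (PosFunctional.tendsto_slice h1 ht (G.comul a))
  refine tendsto_nhds_unique t1 (((ht a).const_mul (g 1)).congr' ?_)
  refine Ultrafilter.of_le _ ((eventually_ge_atTop {g}).mono fun F hgF => ?_)
  exact (hφ F g (Finset.singleton_subset_iff.mp hgF) a).symm

end CompactQuantumGroup

end HaarState

/-! ### Averaging over the Haar state and the consequences of ergodicity -/

noncomputable section Ergodicity

variable {A C : Type u} [CStarAlgebra A] [CStarAlgebra C]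

theorem spatialLeft_apply (c : C) : spatialLeft C A c = tens c 1 := rfl

theorem tens_smul_right (r : ℂ) (c : C) (a : A) : tens c (r • a) = r • tens c a :=
  (congrArg (spatialOf C A) (TensorProduct.tmul_smul r c a)).trans (map_smul (spatialOf C A) _ _)

theorem slice_mem {V : Submodule ℂ C} (hV : IsClosed (V : Set C)) (f : PosFunctional A)
    {x : Spatial C A} (hx : x ∈ tensorWith (V : Set C) A) : slice C f x ∈ V := by
  have hle : tensorWith (V : Set C) A ≤ V.comap (slice C f).toLinearMap := by
    refine Submodule.topologicalClosure_minimal _ (Submodule.span_le.mpr ?_)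
      (hV.preimage (slice C f).continuous)
    rintro _ ⟨c, hc, a, rfl⟩
    change slice C f (tens c a) ∈ V
    rw [slice_tens]
    exact V.smul_mem _ hc
  exact hle hx

/-- The left kernel of the product functional `f ⊗ g`. -/
def leftKernel (f : PosFunctional C) (g : PosFunctional A) : Ideal (Spatial C A) where
  carrier := {y | ∀ z, f (slice C g (z * y)) = 0}
  add_mem' hx hy z := by rw [mul_add, map_add, map_add, hx, hy, add_zero]
  zero_mem' z := by rw [mul_zero, map_zero, map_zero]
  smul_mem' c y hy z := by rw [smul_eq_mul, ← mul_assoc]; exact hy _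

section LeftKernel

variable {f : PosFunctional C} {g : PosFunctional A}

/-- Cauchy-Schwarz. The defining condition makes the ideal property immediate, while this form gives
closedness. -/
theorem mem_leftKernel {y : Spatial C A} :
    y ∈ leftKernel f g ↔ f (slice C g (star y * y)) = 0 :=
  ⟨fun h => h _, fun h => slice_mul_eq_zero h⟩

theorem isClosed_leftKernel : IsClosed (leftKernel f g : Set (Spatial C A)) := by
  have : (leftKernel f g : Set (Spatial C A)) = {y | f (slice C g (star y * y)) = 0} :=
    Set.ext fun _ => mem_leftKernel
  rw [this]
  exact isClosed_eq (f.toDual.continuous.comp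
    ((slice C g).continuous.comp (continuous_star.mul continuous_id))) continuous_const

variable (f g) in
/-- The hereditary C*-subalgebra given by the left kernel of `f ⊗ g`. -/
def leftKernelHereditary : NonUnitalStarSubalgebra ℂ (Spatial C A) where
  carrier := {y | y ∈ leftKernel f g ∧ star y ∈ leftKernel f g}
  add_mem' hx hy := ⟨add_mem hx.1 hy.1, by rw [star_add]; exact add_mem hx.2 hy.2⟩
  zero_mem' := ⟨zero_mem _, by rw [star_zero]; exact zero_mem _⟩
  mul_mem' {x y} hx hy := ⟨(leftKernel f g).mul_mem_left x hy.1, by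
    rw [star_mul]; exact (leftKernel f g).mul_mem_left _ hx.2⟩
  smul_mem' c x hx := ⟨((leftKernel f g).restrictScalars ℂ).smul_mem c hx.1, by
    rw [star_smul]; exact ((leftKernel f g).restrictScalars ℂ).smul_mem _ hx.2⟩
  star_mem' hx := ⟨hx.2, by rw [star_star]; exact hx.1⟩

-- If z*z ≤ h and the functional vanishes at h = w*w + z*z, it vanishes at both summands, so z and
-- hence z*z lie in the left kernel.
open scoped ComplexOrder in
theorem isHereditary_leftKernelHereditary : IsHereditary (leftKernelHereditary f g) where
  isClosed := isClosed_leftKernel.inter (isClosed_leftKernel.preimage continuous_star)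
  mem_of_le := by
    rintro _ h ⟨z, rfl⟩ ⟨w, hw⟩ hm
    have h0 := hm.1 1
    rw [one_mul, ← sub_add_cancel h (star z * z), hw, map_add, map_add] at h0
    have hz : z ∈ leftKernel f g := mem_leftKernel.mpr
      ((add_eq_zero_iff_of_nonneg (nonneg_slice_star_mul_self f g w)
        (nonneg_slice_star_mul_self f g z)).mp h0).2
    have := (leftKernel f g).mul_mem_left (star z) hz
    exact ⟨this, by rwa [star_mul, star_star]⟩

theorem apply_star_mul_self_of_mem_leftKernel (hg : g 1 = 1) {c : C}
    (h : tens c 1 ∈ leftKernel f g) : f (star c * c) = 0 := by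
  have := mem_leftKernel.mp h
  rwa [star_tens, tens_mul_tens, star_one, mul_one, slice_tens, hg, one_smul] at this

end LeftKernel

theorem ideal_eq_top_of_smul_one_mem {I : Ideal C} {r : ℂ} (hr : r ≠ 0)
    (h : algebraMap ℂ C r ∈ I) : I = ⊤ := by
  refine (Ideal.eq_top_iff_one I).mpr ?_
  have := (I.restrictScalars ℂ).smul_mem r⁻¹ (show algebraMap ℂ C r ∈ I.restrictScalars ℂ from h)
  rwa [Algebra.algebraMap_eq_smul_one, smul_smul, inv_mul_cancel₀ hr, one_smul] at this

/-- A hereditary subalgebra that contains `h` contains `h* B h`. -/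
theorem IsHereditary.star_mul_mul_mem {H : NonUnitalStarSubalgebra ℂ C} (hH : IsHereditary H)
    {h : C} (hh : h ∈ H) (y : C) : star h * y * h ∈ H := by
  let _ := CStarAlgebra.spectralOrder C
  have _ := CStarAlgebra.spectralOrderedRing C
  -- Positive elements span, and for y = z*z one has h*z*zh ≤ ‖z‖² h*h, so the order condition
  -- applies.
  have hy : y ∈ Submodule.span ℂ {a : C | 0 ≤ a} := by
    rw [CStarAlgebra.span_nonneg]; trivial
  induction hy using Submodule.span_induction with
  | zero => rw [mul_zero, zero_mul]; exact zero_mem H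
  | add x y _ _ hx hy => rw [mul_add, add_mul]; exact add_mem hx hy
  | smul c x _ hx => rw [mul_smul_comm, smul_mul_assoc]; exact SMulMemClass.smul_mem c hx
  | mem x hx =>
    obtain ⟨z, rfl⟩ := CStarAlgebra.nonneg_iff_eq_star_mul_self.mp (Set.mem_ofPred_eq.mp hx)
    obtain ⟨w, hw⟩ := exists_eq_star_mul_self_sub z
    refine hH.mem_of_le _ (((‖z‖ ^ 2 : ℝ) : ℂ) • (star h * h)) ⟨z * h, ?_⟩ ⟨w * h, ?_⟩ ?_
    · simp only [star_mul, mul_assoc]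
    · have e : star (w * h) * (w * h) = star h * (star w * w) * h := by
        simp only [star_mul, mul_assoc]
      rw [e, ← hw, mul_sub, sub_mul, mul_smul_comm, smul_mul_assoc, mul_one]
    · exact SMulMemClass.smul_mem _ (mul_mem (star_mem hh) hh)

theorem hereditary_eq_top_of_smul_one_mem {H : NonUnitalStarSubalgebra ℂ C} (hH : IsHereditary H)
    {r : ℂ} (hr : r ≠ 0) (h : algebraMap ℂ C r ∈ H) : H = ⊤ := by
  have h1 : (1 : C) ∈ H := by
    have := SMulMemClass.smul_mem r⁻¹ h
    rwa [Algebra.algebraMap_eq_smul_one, smul_smul, inv_mul_cancel₀ hr, one_smul] at this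
  refine eq_top_iff.mpr fun y _ => ?_
  have := hH.star_mul_mul_mem h1 y
  rwa [star_one, one_mul, mul_one] at this

/-- Invariance under a scalar-valued map forces p = t·1 for a complex number t, and p² = p gives t²
= t. -/
theorem isProj_eq_zero_or_one {p : Bidual C} (hp : IsProj p) {E : C →L[ℂ] C}
    (hE : ∀ x, E x ∈ Set.range (algebraMap ℂ C)) (h : ∀ φ : StrongDual ℂ C, p (φ.comp E) = p φ) :
    p = 0 ∨ p = toBidual 1 := by
  rcases subsingleton_or_nontrivial C with hC | hC
  · left
    ext φ
    have : φ = 0 := by ext x; rw [Subsingleton.elim x 0, map_zero, map_zero]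
    rw [this, map_zero, map_zero]
  obtain ⟨f, hf, -⟩ := exists_state (0 : C)
  -- As E is scalar-valued and f(1) = 1, the functional φ ∘ E equals φ(1)·(f ∘ E).
  have hpφ : ∀ φ : StrongDual ℂ C, p φ = φ 1 * p (f.toDual.comp E) := fun φ => by
    rw [← h φ, ← smul_eq_mul, ← map_smul]
    congr 1
    ext x
    obtain ⟨r, hr⟩ := hE x
    simp only [ContinuousLinearMap.comp_apply, _root_.smul_apply, ← hr,
      Algebra.algebraMap_eq_smul_one, map_smul, hf, smul_eq_mul]
    ring
  set t := p (f.toDual.comp E)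
  have ht : t * t = t := by
    have h1 := congrArg (fun Φ : Bidual C => Φ f.toDual) hp.1
    change p (bidualSlice p f.toDual) = p f.toDual at h1
    rw [hpφ (bidualSlice p f.toDual), hpφ f.toDual, bidualSlice_apply, hpφ, dualMul_apply, mul_one,
      hf, one_mul] at h1
    exact h1
  rcases eq_or_ne t 0 with h0 | h0
  · left; ext φ; rw [hpφ, h0, mul_zero]; rfl
  · have h1 := mul_left_cancel₀ h0 (ht.trans (mul_one t).symm)
    right; ext φ; rw [hpφ, h1, mul_one]; rfl

namespace Action

variable {G : CompactQuantumGroup A} (δ : Action G C)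

/-- The averaging map `(ι ⊗ f)δ`. -/
def average (f : PosFunctional A) : C →L[ℂ] C := (slice C f).comp (homL δ.hom)

theorem average_apply (f : PosFunctional A) (x : C) :
    δ.average f x = slice C f (δ.hom x) := rfl

/-- δ(E(x)) = (ι ⊗ ι ⊗ h)(δ ⊗ ι)δ(x) = (ι ⊗ ι ⊗ h)(ι ⊗ Δ)δ(x), and invariance of h collapses this to
E(x) ⊗ 1. -/
theorem average_mem_fixedPoints {h : PosFunctional A}
    (hh : ∀ a, slice A h (G.comul a) = h a • (1 : A)) (x : C) :
    δ.average h x ∈ δ.fixedPoints := by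
  have e : (slice₃ C A h).comp (homL (idTensor C G.comul)) =
      (homL (spatialLeft C A)).comp (slice C h) := clm_ext_tens fun c a => by
    simp only [ContinuousLinearMap.comp_apply, homL_apply]
    rw [slice₃_idTensor_tens, hh, slice_tens, map_smul, tens_smul_right, spatialLeft_apply]
  change δ.hom (slice C h (δ.hom x)) = tens (slice C h (δ.hom x)) 1
  rw [← slice₃_tensorId, δ.coassoc]
  exact congrArg (fun T => T (δ.hom x)) e

/-- If `A = 0` then all elements are fixed. -/
theorem mem_fixedPoints_of_subsingleton [Subsingleton A] (x : C) : x ∈ δ.fixedPoints := by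
  have h : (0 : Spatial C A) = 1 := by
    rw [← tens_one_one, Subsingleton.elim (1 : A) 0]
    exact (by rw [← zero_smul ℂ (0 : A), tens_smul_right, zero_smul])
  have : Subsingleton (Spatial C A) := subsingleton_of_zero_eq_one h
  exact Subsingleton.elim _ _

variable {δ}

theorem Ergodic.ideal_eq_bot (he : δ.Ergodic) {I : Ideal C} (hI : IsClosed (I : Set C))
    (ht : I ≠ ⊤) (hinv : δ.Invariant I) (hs : δ.spanImage I = tensorWith (I : Set C) A) :
    I = ⊥ := by
  rw [Ergodic] at he
  have hscalar : ∀ x ∈ I, x ∈ δ.fixedPoints → x = 0 := fun x hx hf => by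
    rw [he] at hf
    obtain ⟨r, rfl⟩ := hf
    by_contra hr
    exact ht (ideal_eq_top_of_smul_one_mem (fun h => hr (by rw [h, map_zero])) hx)
  refine (Submodule.eq_bot_iff I).mpr fun x hx => ?_
  -- If A = 0 there is no state to average with, but then every element is fixed.
  rcases subsingleton_or_nontrivial A with hA | hA
  · exact hscalar x hx (δ.mem_fixedPoints_of_subsingleton x)
  obtain ⟨h, h1, hh⟩ := G.exists_haar
  refine eq_zero_of_posFunctional fun f => ?_
  -- The average of s*s stays in I by invariance and is fixed, so it is a scalar in a proper ideal,
  -- namely 0.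
  have hδ : ∀ s ∈ I, δ.hom s ∈ leftKernel f h := fun s hs => by
    rw [mem_leftKernel, ← map_star, ← map_mul]
    have hm := I.mul_mem_left (star s) hs
    have h2 := slice_mem (V := I.restrictScalars ℂ) hI h (hinv _ hm)
    have h3 := hscalar _ h2 (δ.average_mem_fixedPoints hh _)
    rw [h3, map_zero]
  have hle : δ.spanImage I ≤ (leftKernel f h).restrictScalars ℂ := by
    refine Submodule.topologicalClosure_minimal _ (Submodule.span_le.mpr ?_) isClosed_leftKernel
    rintro _ ⟨a, s, hs, rfl⟩
    exact (leftKernel f h).mul_mem_left _ (hδ s hs)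
  refine apply_star_mul_self_of_mem_leftKernel h1 (hle ?_)
  rw [hs]
  exact Submodule.le_topologicalClosure _ (Submodule.subset_span ⟨x, hx, 1, rfl⟩)

theorem Ergodic.hereditary_eq_bot (he : δ.Ergodic) {H : NonUnitalStarSubalgebra ℂ C}
    (hH : IsHereditary H) (ht : H ≠ ⊤) (hinv : δ.Invariant H)
    (hs : (hereditaryHull (δ.hom '' H) : Set (Spatial C A)) = tensorWith (H : Set C) A) :
    H = ⊥ := by
  rw [Ergodic] at he
  have hscalar : ∀ x ∈ H, x ∈ δ.fixedPoints → x = 0 := fun x hx hf => by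
    rw [he] at hf
    obtain ⟨r, rfl⟩ := hf
    by_contra hr
    exact ht (hereditary_eq_top_of_smul_one_mem hH (fun h => hr (by rw [h, map_zero])) hx)
  refine eq_bot_iff.mpr fun x hx => ?_
  rw [NonUnitalStarAlgebra.mem_bot]
  rcases subsingleton_or_nontrivial A with hA | hA
  · exact hscalar x hx (δ.mem_fixedPoints_of_subsingleton x)
  obtain ⟨h, h1, hh⟩ := G.exists_haar
  refine eq_zero_of_posFunctional fun f => ?_
  have hδ : ∀ s ∈ H, δ.hom s ∈ leftKernel f h := fun s hs => by
    rw [mem_leftKernel, ← map_star, ← map_mul]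
    have hm : star s * s ∈ H := mul_mem (star_mem hs) hs
    have h2 := slice_mem (V := H.toSubmodule) hH.isClosed h (hinv _ hm)
    have h3 := hscalar _ h2 (δ.average_mem_fixedPoints hh _)
    rw [h3, map_zero]
  -- The kernel subalgebra is one of the competitors in the intersection defining the hull.
  have hle : hereditaryHull (δ.hom '' H) ≤ leftKernelHereditary f h := by
    refine sInf_le ⟨isHereditary_leftKernelHereditary, ?_⟩
    rintro _ ⟨s, hs, rfl⟩
    exact ⟨hδ s hs, by rw [← map_star]; exact hδ _ (star_mem hs)⟩
  have hx1 : tens x 1 ∈ (hereditaryHull (δ.hom '' H) : Set (Spatial C A)) := by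
    rw [hs]
    exact Submodule.le_topologicalClosure _ (Submodule.subset_span ⟨x, hx, 1, rfl⟩)
  exact apply_star_mul_self_of_mem_leftKernel h1 (hle hx1).1

theorem Ergodic.proj_eq_zero_or_one (he : δ.Ergodic) {p : Bidual C} (hp : IsProj p)
    (h : bidualMap δ.hom p = bidualMap (spatialLeft C A) p) : p = 0 ∨ p = toBidual 1 := by
  rw [Ergodic] at he
  rcases subsingleton_or_nontrivial A with hA | hA
  · exact isProj_eq_zero_or_one hp (E := ContinuousLinearMap.id ℂ C)
      (fun x => he ▸ δ.mem_fixedPoints_of_subsingleton x) fun φ => rfl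
  obtain ⟨f, h1, hf⟩ := G.exists_haar
  refine isProj_eq_zero_or_one hp (E := δ.average f)
    (fun x => he ▸ δ.average_mem_fixedPoints hf x) fun φ => ?_
  -- Testing δ''(p) = p ⊗ 1 on φ ∘ (ι ⊗ f): the left side is p(φ ∘ E), and the right side is p(φ)
  -- because f(1) = 1.
  refine (congrArg (fun Φ : Bidual (Spatial C A) => Φ (φ.comp (slice C f))) h).trans ?_
  change p ((φ.comp (slice C f)).comp (homL (spatialLeft C A))) = p φ
  congr 1
  ext c
  simp only [ContinuousLinearMap.comp_apply, homL_apply]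
  rw [spatialLeft_apply, slice_tens, h1, one_smul]

end Action

end Ergodicity

/-! ### Ideals and hereditary subalgebras supported by a sequence of fixed elements -/

noncomputable section SupportUnits

open Filter Topology

variable {A B C : Type u} [CStarAlgebra A] [CStarAlgebra B] [CStarAlgebra C]

/-- A sequence of self-adjoint contractions with `e_n e_m = e_n` for large `m`. -/
structure IsSupportUnit (e : ℕ → B) : Prop where
  star_eq : ∀ n, star (e n) = e n
  norm_le : ∀ n, ‖e n‖ ≤ 1
  mul_eq : ∀ n, ∃ N, ∀ m ≥ N, e n * e m = e n

namespace IsSupportUnit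

theorem map {e : ℕ → B} (he : IsSupportUnit e) (φ : B →⋆ₐ[ℂ] C) :
    IsSupportUnit fun n => φ (e n) where
  star_eq n := by rw [← map_star, he.star_eq]
  norm_le n := (NonUnitalStarAlgHom.norm_apply_le φ _).trans (he.norm_le n)
  mul_eq n := by
    obtain ⟨N, hN⟩ := he.mul_eq n
    exact ⟨N, fun m hm => by rw [← map_mul, hN m hm]⟩

variable {e : ℕ → B} (he : IsSupportUnit e)

/-- The closed left ideal of all `x` with `x e_n → x`. -/
def ideal (_ : IsSupportUnit e) : Ideal B where
  carrier := {x | Tendsto (fun n => x * e n) atTop (𝓝 x)}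
  add_mem' hx hy := by
    simp only [Set.mem_ofPred_eq, add_mul] at *
    exact hx.add hy
  zero_mem' := by
    simp only [Set.mem_ofPred_eq, zero_mul]
    exact tendsto_const_nhds
  smul_mem' c x hx := by
    simp only [Set.mem_ofPred_eq, smul_eq_mul, mul_assoc] at *
    exact hx.const_mul c

theorem mem_ideal {x : B} : x ∈ he.ideal ↔ Tendsto (fun n => x * e n) atTop (𝓝 x) := Iff.rfl

/-- Right multiplications by contractions are equicontinuous, so their points of convergence form a
closed set. -/
theorem isClosed_ideal : IsClosed (he.ideal : Set B) := by
  have hq : Equicontinuous fun (n : ℕ) (x : B) => x * e n :=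
    (LipschitzWith.uniformEquicontinuous _ 1 fun n =>
      AddMonoidHomClass.lipschitz_of_bound_nnnorm (AddMonoidHom.mulRight (e n)) 1 fun x => by
        have : ‖x * e n‖ ≤ 1 * ‖x‖ := (norm_mul_le _ _).trans
          ((mul_le_of_le_one_right (norm_nonneg _) (he.norm_le n)).trans_eq (one_mul _).symm)
        exact_mod_cast this).equicontinuous
  exact hq.isClosed_setOfPred_tendsto continuous_id

theorem mem (n : ℕ) : e n ∈ he.ideal := by
  obtain ⟨N, hN⟩ := he.mul_eq n
  exact tendsto_const_nhds.congr' ((eventually_ge_atTop N).mono fun m hm => (hN m hm).symm)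

theorem mul_mem (x : B) (n : ℕ) : x * e n ∈ he.ideal := he.ideal.mul_mem_left x (he.mem n)

/-- If 1 were in the ideal then e_n → 1, and 0 = e_n g → g. -/
theorem ideal_ne_top {g : B} (hg : g ≠ 0) (h : ∀ n, e n * g = 0) : he.ideal ≠ ⊤ := fun ht => by
  have h1 : (1 : B) ∈ he.ideal := by rw [ht]; trivial
  have h2 := (he.mem_ideal.mp h1).mul_const g
  simp only [one_mul, h] at h2
  exact hg (tendsto_nhds_unique h2 tendsto_const_nhds)

/-- The hereditary subalgebra of all `x` with `x e_n → x` and `e_n x → x`. -/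
def hereditary : NonUnitalStarSubalgebra ℂ B where
  carrier := {x | x ∈ he.ideal ∧ star x ∈ he.ideal}
  add_mem' hx hy := ⟨add_mem hx.1 hy.1, by rw [star_add]; exact add_mem hx.2 hy.2⟩
  zero_mem' := ⟨zero_mem _, by rw [star_zero]; exact zero_mem _⟩
  mul_mem' {x y} hx hy := ⟨he.ideal.mul_mem_left x hy.1, by
    rw [star_mul]; exact he.ideal.mul_mem_left _ hx.2⟩
  smul_mem' c x hx := ⟨(he.ideal.restrictScalars ℂ).smul_mem c hx.1, by
    rw [star_smul]; exact (he.ideal.restrictScalars ℂ).smul_mem _ hx.2⟩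
  star_mem' hx := ⟨hx.2, by rw [star_star]; exact hx.1⟩

theorem mem_hereditary_self (n : ℕ) : e n ∈ he.hereditary :=
  ⟨he.mem n, by rw [he.star_eq]; exact he.mem n⟩

theorem mul_mul_mem_hereditary (x : B) (n : ℕ) : e n * x * e n ∈ he.hereditary :=
  ⟨he.mul_mem _ n, by
    rw [star_mul, star_mul, he.star_eq, ← mul_assoc]; exact he.mul_mem _ n⟩

theorem isClosed_hereditary : IsClosed (he.hereditary : Set B) :=
  he.isClosed_ideal.inter (he.isClosed_ideal.preimage continuous_star)

theorem isHereditary : IsHereditary he.hereditary where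
  isClosed := he.isClosed_hereditary
  mem_of_le := by
    rintro _ h ⟨z, rfl⟩ ⟨w, hw⟩ hm
    have hz : z ∈ he.ideal := by
      rw [mem_ideal, tendsto_iff_norm_sub_tendsto_zero]
      -- (e_n - 1)z*z(e_n - 1) ≤ (e_n - 1)h(e_n - 1) by compressing z*z ≤ h; the factor 2 bounds
      -- ‖e_n - 1‖.
      have hb : ∀ n, ‖z * e n - z‖ ^ 2 ≤ 2 * ‖h * e n - h‖ := fun n => by
        let _ := CStarAlgebra.spectralOrder B
        have _ := CStarAlgebra.spectralOrderedRing B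
        have hle : star (z * e n - z) * (z * e n - z) ≤
            star (e n - 1) * h * (e n - 1) := by
          rw [← sub_nonneg]
          have : star (e n - 1) * h * (e n - 1) - star (z * e n - z) * (z * e n - z) =
              star (w * (e n - 1)) * (w * (e n - 1)) := by
            have e1 : z * e n - z = z * (e n - 1) := by rw [mul_sub, mul_one]
            have e2 : star (w * (e n - 1)) * (w * (e n - 1)) =
                star (e n - 1) * (star w * w) * (e n - 1) := by simp only [star_mul, mul_assoc]
            rw [e1, e2, ← hw, star_mul]
            noncomm_ring
          rw [this]; exact star_mul_self_nonneg _
        have h1 := CStarAlgebra.norm_le_norm_of_nonneg_of_le (star_mul_self_nonneg _) hle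
        rw [CStarRing.norm_star_mul_self, ← sq, mul_assoc, mul_sub h, mul_one] at h1
        refine h1.trans ((norm_mul_le _ _).trans
          (mul_le_mul_of_nonneg_right ?_ (norm_nonneg _)))
        rw [norm_star]
        refine (norm_sub_le _ _).trans ?_
        have : ‖(1 : B)‖ ≤ 1 := by
          rcases subsingleton_or_nontrivial B with hB | hB
          · rw [Subsingleton.elim (1 : B) 0, norm_zero]; exact zero_le_one
          · rw [norm_one]
        linarith [he.norm_le n]
      have ht : Tendsto (fun n => 2 * ‖h * e n - h‖) atTop (𝓝 0) := by
        simpa using (tendsto_iff_norm_sub_tendsto_zero.mp (he.mem_ideal.mp hm.1)).const_mul 2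
      have hs := squeeze_zero (fun n => sq_nonneg _) hb ht
      have := hs.sqrt
      simpa only [Real.sqrt_sq (norm_nonneg _), Real.sqrt_zero] using this
    have := he.ideal.mul_mem_left (star z) hz
    exact ⟨this, by rwa [star_mul, star_star]⟩

theorem tendsto_of_mem_hereditary {x : B} (hx : x ∈ he.hereditary) :
    Tendsto (fun n => e n * x * e n) atTop (𝓝 x) := by
  have h1 : Tendsto (fun n => e n * x) atTop (𝓝 x) := by
    have := (he.mem_ideal.mp hx.2).star
    simpa only [star_mul, star_star, he.star_eq] using this
  have h2 : Tendsto (fun n => e n * (x * e n - x)) atTop (𝓝 0) := by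
    refine squeeze_zero_norm (fun n => ?_) (tendsto_iff_norm_sub_tendsto_zero.mp
      (he.mem_ideal.mp hx.1))
    exact (norm_mul_le _ _).trans (mul_le_of_le_one_left (norm_nonneg _) (he.norm_le n))
  have h3 := h2.add h1
  rw [zero_add] at h3
  refine h3.congr fun n => ?_
  rw [mul_sub, sub_add_cancel, mul_assoc]

theorem hereditary_ne_top {g : B} (hg : g ≠ 0) (h : ∀ n, e n * g = 0) : he.hereditary ≠ ⊤ :=
  fun ht => he.ideal_ne_top hg h <| (Ideal.eq_top_iff_one _).mpr
    (show (1 : B) ∈ he.hereditary by rw [ht]; trivial).1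

end IsSupportUnit

section TensorWith

variable {e : ℕ → C} (he : IsSupportUnit e)

/-- Replaces membership in I ⊗ A by the condition y(e_n ⊗ 1) → y. For arbitrary y each y(e_n ⊗ 1)
lies in I ⊗ A, as one checks on elementary tensors, so the limit does too. -/
theorem tensorWith_ideal : (tensorWith (he.ideal : Set C) A : Set (Spatial C A)) =
    (he.map (spatialLeft C A)).ideal := by
  refine Set.Subset.antisymm ?_ fun y hy => ?_
  · refine Submodule.topologicalClosure_minimal _ (t := Submodule.restrictScalars ℂ
      (he.map (spatialLeft C A)).ideal) (Submodule.span_le.mpr ?_)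
      (he.map (spatialLeft C A)).isClosed_ideal
    rintro _ ⟨s, hs, a, rfl⟩
    refine (((continuous_tens_left a).tendsto s).comp (he.mem_ideal.mp hs)).congr fun n => ?_
    change tens (s * e n) a = tens s a * tens (e n) 1
    rw [tens_mul_tens, mul_one]
  · have hc : IsClosed (tensorWith (he.ideal : Set C) A : Set (Spatial C A)) :=
      Submodule.isClosed_topologicalClosure _
    refine hc.mem_of_tendsto ((IsSupportUnit.mem_ideal _).mp hy) (Eventually.of_forall fun n => ?_)
    refine spatial_induction (p := fun y => y * spatialLeft C A (e n) ∈
      tensorWith (he.ideal : Set C) A) (hc.preimage (continuous_id.mul continuous_const))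
      (by rw [zero_mul]; exact zero_mem _) (fun x y hx hy => by rw [add_mul]; exact add_mem hx hy)
      (fun c a => ?_) y
    rw [spatialLeft_apply, tens_mul_tens, mul_one]
    exact Submodule.le_topologicalClosure _ (Submodule.subset_span ⟨_, he.mul_mem c n, a, rfl⟩)

/-- The two-sided analogue, with the compressions (e_n ⊗ 1)y(e_n ⊗ 1) as approximants. -/
theorem tensorWith_hereditary : (tensorWith (he.hereditary : Set C) A : Set (Spatial C A)) =
    (he.map (spatialLeft C A)).hereditary := by
  refine Set.Subset.antisymm ?_ fun y hy => ?_
  · refine Submodule.topologicalClosure_minimal _ 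
      (t := (he.map (spatialLeft C A)).hereditary.toSubmodule) (Submodule.span_le.mpr ?_)
      (he.map (spatialLeft C A)).isClosed_hereditary
    rintro _ ⟨s, hs, a, rfl⟩
    have key : ∀ s ∈ he.ideal, ∀ a : A, tens s a ∈ (he.map (spatialLeft C A)).ideal :=
      fun s hs a => by
        rw [← SetLike.mem_coe, ← tensorWith_ideal he]
        exact Submodule.le_topologicalClosure _ (Submodule.subset_span ⟨s, hs, a, rfl⟩)
    exact ⟨key s hs.1 a, by rw [star_tens]; exact key _ hs.2 _⟩
  · have hc : IsClosed (tensorWith (he.hereditary : Set C) A : Set (Spatial C A)) :=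
      Submodule.isClosed_topologicalClosure _
    refine hc.mem_of_tendsto (IsSupportUnit.tendsto_of_mem_hereditary _ hy)
      (Eventually.of_forall fun n => ?_)
    refine spatial_induction (p := fun y => spatialLeft C A (e n) * y * spatialLeft C A (e n) ∈
      tensorWith (he.hereditary : Set C) A)
      (hc.preimage (f := fun y => spatialLeft C A (e n) * y * spatialLeft C A (e n))
        (by fun_prop))
      (by rw [mul_zero, zero_mul]; exact zero_mem _)
      (fun x y hx hy => by rw [mul_add, add_mul]; exact add_mem hx hy) (fun c a => ?_) y
    rw [spatialLeft_apply, tens_mul_tens, tens_mul_tens, mul_one, one_mul]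
    exact Submodule.le_topologicalClosure _
      (Submodule.subset_span ⟨_, he.mul_mul_mem_hereditary c n, a, rfl⟩)

end TensorWith

namespace Action

variable {G : CompactQuantumGroup A} {δ : Action G C} {e : ℕ → C} (he : IsSupportUnit e)

theorem hom_mem_ideal (hf : ∀ n, e n ∈ δ.fixedPoints) {x : C} (hx : x ∈ he.ideal) :
    δ.hom x ∈ (he.map (spatialLeft C A)).ideal := by
  refine (((continuous_hom δ.hom).tendsto x).comp (he.mem_ideal.mp hx)).congr fun n => ?_
  rw [Function.comp_apply, map_mul, hf n]; rfl

theorem invariant_ideal (hf : ∀ n, e n ∈ δ.fixedPoints) : δ.Invariant he.ideal := fun s hs => by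
  rw [← SetLike.mem_coe, tensorWith_ideal]
  exact hom_mem_ideal he hf hs

/-- Multiplying the dense span of (I ⊗ A)δ(C) on the right by e_n ⊗ 1 = δ(e_n) gives elements of (I
⊗ A)δ(Ce_n), and Ce_n lies in the ideal. So y(e_n ⊗ 1) is in the closed span for every y. -/
theorem spanImage_ideal (hf : ∀ n, e n ∈ δ.fixedPoints) (hδ : δ.Nondegenerate) :
    δ.spanImage he.ideal = tensorWith (he.ideal : Set C) A := by
  refine le_antisymm ?_ fun y hy => ?_
  · refine Submodule.topologicalClosure_minimal _ (Submodule.span_le.mpr ?_)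
      (Submodule.isClosed_topologicalClosure _)
    rintro _ ⟨a, s, hs, rfl⟩
    rw [tensorWith_ideal]
    exact Ideal.mul_mem_left _ _ (hom_mem_ideal he hf hs)
  · rw [← SetLike.mem_coe, tensorWith_ideal] at hy
    have hc : IsClosed (δ.spanImage he.ideal : Set (Spatial C A)) :=
      Submodule.isClosed_topologicalClosure _
    refine hc.mem_of_tendsto ((IsSupportUnit.mem_ideal _).mp hy) (Eventually.of_forall fun n => ?_)
    have hle : δ.spanImage Set.univ ≤ (δ.spanImage he.ideal).comap
        (LinearMap.mulRight ℂ (spatialLeft C A (e n))) := by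
      refine Submodule.topologicalClosure_minimal _ (Submodule.span_le.mpr ?_)
        (hc.preimage (continuous_id.mul continuous_const))
      rintro _ ⟨a, s, -, rfl⟩
      change tens 1 a * δ.hom s * spatialLeft C A (e n) ∈ δ.spanImage he.ideal
      rw [spatialLeft_apply, ← hf n, mul_assoc, ← map_mul]
      exact Submodule.le_topologicalClosure _
        (Submodule.subset_span ⟨a, _, he.mul_mem s n, rfl⟩)
    rw [Nondegenerate] at hδ
    rw [hδ] at hle
    exact hle (Submodule.mem_top (x := y))

theorem hom_mem_hereditary (hf : ∀ n, e n ∈ δ.fixedPoints) {x : C} (hx : x ∈ he.hereditary) :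
    δ.hom x ∈ (he.map (spatialLeft C A)).hereditary :=
  ⟨hom_mem_ideal he hf hx.1, by rw [← map_star]; exact hom_mem_ideal he hf hx.2⟩

theorem invariant_hereditary (hf : ∀ n, e n ∈ δ.fixedPoints) :
    δ.Invariant he.hereditary := fun s hs => by
  rw [← SetLike.mem_coe, tensorWith_hereditary]
  exact hom_mem_hereditary he hf hs

/-- The hull contains δ(e_n) = e_n ⊗ 1, hence all (e_n ⊗ 1)y(e_n ⊗ 1), and these converge to y when
y lies in the tensor product of the subalgebra with A. -/
theorem hereditaryHull_hereditary (hf : ∀ n, e n ∈ δ.fixedPoints) :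
    (hereditaryHull (δ.hom '' he.hereditary) : Set (Spatial C A)) =
      tensorWith (he.hereditary : Set C) A := by
  rw [tensorWith_hereditary]
  refine Set.Subset.antisymm ?_ fun y hy => ?_
  · refine sInf_le (α := NonUnitalStarSubalgebra ℂ (Spatial C A))
      ⟨IsSupportUnit.isHereditary _, ?_⟩
    rintro _ ⟨s, hs, rfl⟩
    exact hom_mem_hereditary he hf hs
  · have hH := isHereditary_hereditaryHull (δ.hom '' he.hereditary)
    refine hH.isClosed.mem_of_tendsto (IsSupportUnit.tendsto_of_mem_hereditary _ hy)
      (Eventually.of_forall fun n => ?_)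
    have := hH.star_mul_mul_mem
      (subset_hereditaryHull _ ⟨e n, he.mem_hereditary_self n, rfl⟩) y
    rwa [← map_star, he.star_eq, hf n] at this

end Action

end SupportUnits

/-! ### Open projections as weak-* limits of increasing sequences -/

noncomputable section OpenProjections

open Filter Topology

variable {A B C : Type u} [CStarAlgebra A] [CStarAlgebra B] [CStarAlgebra C]

theorem isPos_iff_nonneg [PartialOrder B] [StarOrderedRing B] {x : B} : IsPos x ↔ 0 ≤ x :=
  CStarAlgebra.nonneg_iff_eq_star_mul_self.symm

section Monotone

variable {e : ℕ → B}

/-- Any finite sum of distinct increments lies between 0 and some e_N, so its norm is at most 1.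
This bounds all partial sums of Re φ, for arbitrary φ, without decomposing φ into positive
functionals. -/
theorem summable_re_of_monotone (hpos : ∀ n, IsPos (e n))
    (hmono : ∀ i j, i ≤ j → IsPos (e j - e i)) (hnorm : ∀ n, ‖e n‖ ≤ 1)
    (φ : StrongDual ℂ B) :
    Summable fun k => (φ (e (k + 1) - e k)).re := by
  let _ := CStarAlgebra.spectralOrder B
  have _ := CStarAlgebra.spectralOrderedRing B
  have hd : ∀ k, 0 ≤ e (k + 1) - e k := fun k => isPos_iff_nonneg.mp (hmono _ _ k.le_succ)
  have hT : ∀ (N : ℕ) (T : Finset ℕ), T ⊆ Finset.range N →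
      |∑ k ∈ T, (φ (e (k + 1) - e k)).re| ≤ ‖φ‖ := fun N T hT => by
    have h1 : ∑ k ∈ T, (e (k + 1) - e k) ≤ e N := by
      refine (Finset.sum_le_sum_of_subset_of_nonneg hT fun k _ _ => hd k).trans ?_
      rw [Finset.sum_range_sub]
      exact sub_le_self _ (isPos_iff_nonneg.mp (hpos 0))
    have h2 := (CStarAlgebra.norm_le_norm_of_nonneg_of_le
      (Finset.sum_nonneg fun k _ => hd k) h1).trans (hnorm N)
    rw [← Complex.re_sum, ← map_sum]
    exact (Complex.abs_re_le_norm _).trans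
      ((φ.le_opNorm _).trans (mul_le_of_le_one_right (norm_nonneg _) h2))
  refine Summable.of_abs (summable_of_sum_range_le (c := ‖φ‖ + ‖φ‖) (fun _ => abs_nonneg _)
    fun N => ?_)
  -- Grouping the increments by the sign of Re φ bounds the sum of absolute values by 2‖φ‖.
  rw [← Finset.sum_filter_add_sum_filter_not (Finset.range N)
    (fun k => 0 ≤ (φ (e (k + 1) - e k)).re)]
  refine add_le_add ?_ ?_
  · rw [Finset.sum_congr rfl fun k hk => abs_of_nonneg (Finset.mem_filter.mp hk).2]
    exact (le_abs_self _).trans (hT N _ (Finset.filter_subset _ _))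
  · rw [Finset.sum_congr rfl fun k hk => abs_of_neg (not_le.mp (Finset.mem_filter.mp hk).2),
      Finset.sum_neg_distrib]
    exact (neg_le_abs _).trans (hT N _ (Finset.filter_subset _ _))

theorem exists_tendsto_re_of_monotone (hpos : ∀ n, IsPos (e n))
    (hmono : ∀ i j, i ≤ j → IsPos (e j - e i)) (hnorm : ∀ n, ‖e n‖ ≤ 1)
    (φ : StrongDual ℂ B) :
    ∃ r : ℝ, Tendsto (fun n => (φ (e n)).re) atTop (𝓝 r) := by
  have h := (summable_re_of_monotone hpos hmono hnorm φ).hasSum.tendsto_sum_nat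
  have h2 := h.add_const (φ (e 0)).re
  refine ⟨_, h2.congr fun n => ?_⟩
  rw [← Complex.re_sum, ← map_sum, Finset.sum_range_sub, map_sub, Complex.sub_re, sub_add_cancel]

/-- A bounded increasing sequence converges in the weak-* topology of the bidual. -/
theorem exists_bidual_limit_of_monotone (hpos : ∀ n, IsPos (e n))
    (hmono : ∀ i j, i ≤ j → IsPos (e j - e i)) (hnorm : ∀ n, ‖e n‖ ≤ 1) :
    ∃ p : Bidual B, ∀ φ : StrongDual ℂ B, Tendsto (fun n => φ (e n)) atTop (𝓝 (p φ)) := by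
  have h : ∀ φ : StrongDual ℂ B, ∃ z : ℂ, Tendsto (fun n => φ (e n)) atTop (𝓝 z) := fun φ => by
    obtain ⟨r, hr⟩ := exists_tendsto_re_of_monotone hpos hmono hnorm φ
    -- The imaginary part of φ is the real part of -iφ.
    obtain ⟨s, hs⟩ := exists_tendsto_re_of_monotone hpos hmono hnorm ((-Complex.I) • φ)
    refine ⟨r + s * Complex.I, ?_⟩
    have hr' := (Complex.continuous_ofReal.tendsto r).comp hr
    have hs' := ((Complex.continuous_ofReal.tendsto s).comp hs).mul_const Complex.I
    refine (hr'.add hs').congr fun n => ?_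
    simp only [Function.comp_apply, _root_.smul_apply, smul_eq_mul]
    have : ((-Complex.I) * φ (e n)).re = (φ (e n)).im := by simp
    rw [this, Complex.re_add_im]
  choose z hz using h
  exact ⟨continuousLinearMapOfTendsto (fun n => toBidual (e n)) (tendsto_pi_nhds.mpr hz), hz⟩

end Monotone

namespace IsSupportUnit

variable {e : ℕ → B} {p : Bidual B}

/-- Letting m tend to infinity in e_n e_m = e_n gives e_n p = e_n for the Arens product; letting n
tend to infinity gives p² = p. -/
theorem isProj_limit (he : IsSupportUnit e)
    (hp : ∀ φ : StrongDual ℂ B, Tendsto (fun n => φ (e n)) atTop (𝓝 (p φ))) : IsProj p := by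
  constructor
  · ext φ
    change p (bidualSlice p φ) = p φ
    refine tendsto_nhds_unique (hp (bidualSlice p φ)) ((hp φ).congr fun n => ?_)
    obtain ⟨N, hN⟩ := he.mul_eq n
    rw [bidualSlice_apply]
    refine tendsto_nhds_unique ?_ (hp (dualMul φ (e n)))
    refine tendsto_const_nhds.congr' ((eventually_ge_atTop N).mono fun m hm => ?_)
    exact congrArg φ (hN m hm).symm
  · ext φ
    rw [bidualStar_apply]
    refine tendsto_nhds_unique (hp (dualStar φ)).star ((hp φ).congr fun n => ?_)
    rw [dualStar_apply, star_star, he.star_eq]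

theorem limit_ne_zero (he : IsSupportUnit e)
    (hp : ∀ φ : StrongDual ℂ B, Tendsto (fun n => φ (e n)) atTop (𝓝 (p φ))) {n : ℕ}
    (hn : e n ≠ 0) : p ≠ 0 := by
  rintro rfl
  obtain ⟨φ, -, hφ⟩ := exists_dual_vector'' ℂ (e n)
  obtain ⟨N, hN⟩ := he.mul_eq n
  have h1 : φ (e n) = 0 := by
    refine tendsto_nhds_unique ?_ (hp (dualMul φ (e n)))
    refine tendsto_const_nhds.congr' ((eventually_ge_atTop N).mono fun m hm => ?_)
    exact congrArg φ (hN m hm).symm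
  rw [h1] at hφ
  exact hn (norm_eq_zero.mp (Complex.ofReal_eq_zero.mp hφ.symm))

/-- If p = 1, then φ(g*) = lim φ(g* e_n) = 0 for all φ. The adjoint of g is needed because `dualMul`
multiplies from the left. -/
theorem limit_ne_one (he : IsSupportUnit e)
    (hp : ∀ φ : StrongDual ℂ B, Tendsto (fun n => φ (e n)) atTop (𝓝 (p φ)))
    {g : B} (hg : g ≠ 0) (h : ∀ n, e n * g = 0) : p ≠ toBidual 1 := by
  rintro rfl
  obtain ⟨φ, -, hφ⟩ := exists_dual_vector'' ℂ (star g)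
  have h1 : φ (star g) = 0 := by
    have h2 := hp (dualMul φ (star g))
    have h3 : ∀ n, star g * e n = 0 := fun n => by
      rw [← star_inj, star_mul, star_star, he.star_eq, h, star_zero]
    simp only [dualMul_apply, h3, map_zero] at h2
    have h4 := tendsto_nhds_unique h2 tendsto_const_nhds
    change φ (star g * 1) = 0 at h4
    rwa [mul_one] at h4
  rw [h1] at hφ
  exact hg (star_eq_zero.mp (norm_eq_zero.mp (Complex.ofReal_eq_zero.mp hφ.symm)))

theorem isOpenProj_limit (he : IsSupportUnit e)
    (hp : ∀ φ : StrongDual ℂ B, Tendsto (fun n => φ (e n)) atTop (𝓝 (p φ)))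
    (hpos : ∀ n, IsPos (e n))
    (hmono : ∀ i j, i ≤ j → IsPos (e j - e i)) : IsOpenProj p := by
  -- `ULift` moves the index set ℕ into the universe required by `IsOpenProj`.
  refine ⟨he.isProj_limit hp, ULift.{u} ℕ, inferInstance, ⟨fun i j => ⟨⟨max i.down j.down⟩,
    le_max_left i.down j.down, le_max_right i.down j.down⟩⟩, ⟨⟨0⟩⟩, fun i => e i.down,
    fun i => hpos _, fun i j hij => hmono _ _ hij, fun f => ?_⟩
  refine (hp f).comp (tendsto_atTop.mpr fun b => ?_)
  exact (eventually_ge_atTop (ULift.up b)).mono fun i hi => hi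

end IsSupportUnit

end OpenProjections

/-! ### Functional calculus of a non-scalar fixed element -/

noncomputable section FixedPoints

variable {A C : Type u} [CStarAlgebra A] [CStarAlgebra C]

/-- A self-adjoint element that is not a scalar has two distinct points in its spectrum. -/
theorem exists_lt_mem_spectrum {a : C} (ha : IsSelfAdjoint a)
    (hs : a ∉ Set.range (algebraMap ℂ C)) :
    ∃ s ∈ spectrum ℝ a, ∃ t ∈ spectrum ℝ a, s < t := by
  have h : ∀ r : ℝ, ∃ t ∈ spectrum ℝ a, t ≠ r := fun r => by
    by_contra! hr
    refine hs ⟨r, ?_⟩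
    have := CFC.eq_algebraMap_of_spectrum_subset_singleton (R := ℝ) (a := a) r
      (fun t ht => hr t ht) ha
    rw [this, Algebra.algebraMap_eq_smul_one, Algebra.algebraMap_eq_smul_one, Complex.coe_smul]
  obtain ⟨s, hs, -⟩ := h 0
  obtain ⟨t, ht, hne⟩ := h s
  rcases lt_or_gt_of_ne hne with h | h
  · exact ⟨t, ht, s, hs, h⟩
  · exact ⟨s, hs, t, ht, h⟩

/-- The ramp from `0` to `1` that vanishes up to `r + 1/n`. -/
def ramp (r : ℝ) (n : ℕ) (x : ℝ) : ℝ := max 0 (min 1 (n * (x - r) - 1))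

theorem continuous_ramp (r : ℝ) (n : ℕ) : Continuous (ramp r n) := by
  unfold ramp; fun_prop

theorem ramp_nonneg (r : ℝ) (n : ℕ) (x : ℝ) : 0 ≤ ramp r n x := le_max_left _ _

theorem ramp_le_one (r : ℝ) (n : ℕ) (x : ℝ) : ramp r n x ≤ 1 :=
  max_le zero_le_one (min_le_left _ _)

theorem ramp_eq_zero {r x : ℝ} (n : ℕ) (h : x ≤ r) : ramp r n x = 0 := by
  refine max_eq_left ((min_le_right _ _).trans ?_)
  have : (n : ℝ) * (x - r) ≤ 0 := mul_nonpos_of_nonneg_of_nonpos n.cast_nonneg (sub_nonpos.mpr h)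
  linarith

theorem ramp_eq_one {r x : ℝ} {n : ℕ} (h : 2 ≤ n * (x - r)) : ramp r n x = 1 := by
  unfold ramp
  rw [min_eq_left (by linarith), max_eq_right zero_le_one]

theorem ramp_mono {r : ℝ} {m n : ℕ} (h : m ≤ n) (x : ℝ) : ramp r m x ≤ ramp r n x := by
  rcases le_total x r with hx | hx
  · rw [ramp_eq_zero m hx, ramp_eq_zero n hx]
  · have : (m : ℝ) * (x - r) ≤ n * (x - r) :=
      mul_le_mul_of_nonneg_right (by exact_mod_cast h) (sub_nonneg.mpr hx)
    exact max_le_max le_rfl (min_le_min le_rfl (by linarith))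

/-- The n-th ramp is nonzero only where n(x - r) > 1, and there m(x - r) ≥ 2, so the m-th ramp has
already reached 1. -/
theorem ramp_mul_ramp {r : ℝ} {m n : ℕ} (h : 2 * n ≤ m) (x : ℝ) :
    ramp r n x * ramp r m x = ramp r n x := by
  rcases le_or_gt (n * (x - r)) 1 with hx | hx
  · have : ramp r n x = 0 := max_eq_left ((min_le_right _ _).trans (by linarith))
    rw [this, zero_mul]
  · have h0 : 0 < x - r := by
      by_contra! h0
      have := mul_nonpos_of_nonneg_of_nonpos (n.cast_nonneg (α := ℝ)) h0
      linarith
    have hm : (2 * n : ℝ) * (x - r) ≤ m * (x - r) :=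
      mul_le_mul_of_nonneg_right (by exact_mod_cast h) h0.le
    rw [ramp_eq_one (n := m) (by linarith), mul_one]

/-- The pointwise properties of the ramps pass through the functional calculus; if a is not
self-adjoint, `cfc` is 0 and they hold trivially. -/
theorem isSupportUnit_ramp {a : C} (r : ℝ) :
    IsSupportUnit fun n => cfc (ramp r n) a where
  star_eq n := (cfc_predicate (p := IsSelfAdjoint) (ramp r n) a).star_eq
  norm_le n := norm_cfc_le zero_le_one fun x _ => by
    rw [Real.norm_of_nonneg (ramp_nonneg r n x)]; exact ramp_le_one r n x
  mul_eq n := ⟨2 * n, fun m hm => by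
    rw [← cfc_mul _ _ a (continuous_ramp r n).continuousOn (continuous_ramp r m).continuousOn]
    exact cfc_congr fun x _ => ramp_mul_ramp hm x⟩

namespace Action

variable {G : CompactQuantumGroup A} {δ : Action G C}

/-- Fixed points are where the unital *-homomorphisms δ and c ↦ c ⊗ 1 agree, and both commute with
functional calculus. -/
theorem cfc_mem_fixedPoints {a : C} (ha : IsSelfAdjoint a) (hf : a ∈ δ.fixedPoints) {f : ℝ → ℝ}
    (hc : Continuous f) : cfc f a ∈ δ.fixedPoints := by
  have h1 := StarAlgHomClass.map_cfc (S := ℂ) δ.hom f a hc.continuousOn (continuous_hom _) ha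
    (ha.map δ.hom)
  have h2 := StarAlgHomClass.map_cfc (S := ℂ) (spatialLeft C A) f a hc.continuousOn
    (continuous_hom _) ha (ha.map (spatialLeft C A))
  change δ.hom _ = spatialLeft C A _
  rw [h1, h2]
  exact congrArg _ hf

/-- The real and imaginary parts of a fixed element are fixed, and if both were scalars so would be
the element. -/
theorem exists_selfAdjoint_fixed (h : ¬ δ.Ergodic) :
    ∃ a ∈ δ.fixedPoints, IsSelfAdjoint a ∧ a ∉ Set.range (algebraMap ℂ C) := by
  have hsub : Set.range (algebraMap ℂ C) ⊆ δ.fixedPoints := by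
    rintro _ ⟨r, rfl⟩
    change δ.hom (algebraMap ℂ C r) = spatialLeft C A (algebraMap ℂ C r)
    rw [AlgHomClass.commutes, AlgHomClass.commutes]
  obtain ⟨c, hc, hcs⟩ : ∃ c ∈ δ.fixedPoints, c ∉ Set.range (algebraMap ℂ C) := by
    by_contra! hall
    exact h (Set.Subset.antisymm hall hsub)
  have hc' : δ.hom c = spatialLeft C A c := hc
  by_contra! hall
  have hre : ((realPart c : selfAdjoint C) : C) ∈ δ.fixedPoints := by
    change δ.hom _ = spatialLeft C A _
    rw [realPart_apply_coe, ← Complex.coe_smul, map_smul, map_smul, map_add, map_add,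
      map_star, map_star, hc']
  have him : ((imaginaryPart c : selfAdjoint C) : C) ∈ δ.fixedPoints := by
    change δ.hom _ = spatialLeft C A _
    rw [imaginaryPart_apply_coe, ← Complex.coe_smul, map_smul, map_smul, map_smul, map_smul,
      map_sub, map_sub, map_star, map_star, hc']
  obtain ⟨r, hr⟩ := hall _ hre (realPart c).2
  obtain ⟨s, hs⟩ := hall _ him (imaginaryPart c).2
  refine hcs ⟨r + Complex.I * s, ?_⟩
  rw [map_add, map_mul, hr, hs, ← Algebra.smul_def]
  exact realPart_add_I_smul_imaginaryPart c

/-- The single source of all three counterexamples. With r between two spectral points s < t of a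
fixed a, the ramps above r are eventually nonzero at t, and g = (r - a)₊ is nonzero because of s and
annihilated by every ramp. -/
theorem exists_supportUnit_of_not_ergodic (h : ¬ δ.Ergodic) :
    ∃ (e : ℕ → C) (g : C), IsSupportUnit e ∧ (∀ n, e n ∈ δ.fixedPoints) ∧ (∃ n, e n ≠ 0) ∧
      g ≠ 0 ∧ (∀ n, e n * g = 0) ∧ (∀ n, IsPos (e n)) ∧ ∀ i j, i ≤ j → IsPos (e j - e i) := by
  obtain ⟨a, haf, ha, has⟩ := exists_selfAdjoint_fixed h
  obtain ⟨s, hs, t, ht, hst⟩ := exists_lt_mem_spectrum ha has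
  set r := (s + t) / 2
  have hg : Continuous fun x : ℝ => max 0 (r - x) := by fun_prop
  have hcfc : ∀ {f : ℝ → ℝ}, Continuous f → ∀ {x}, x ∈ spectrum ℝ a → f x ≠ 0 →
      cfc f a ≠ 0 := fun {f} hf {x} hx hne h0 => by
    rw [← cfc_zero ℝ a, cfc_eq_cfc_iff_eqOn (R := ℝ) (ha := ha) (hf := hf.continuousOn)] at h0
    exact hne (h0 hx)
  let _ := CStarAlgebra.spectralOrder C
  have _ := CStarAlgebra.spectralOrderedRing C
  refine ⟨fun n => cfc (ramp r n) a, cfc (fun x => max 0 (r - x)) a, isSupportUnit_ramp r,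
    fun n => cfc_mem_fixedPoints ha haf (continuous_ramp r n), ?_, hcfc hg hs ?_, fun n => ?_,
    fun n => ?_, fun i j hij => ?_⟩
  -- For such n the ramp has reached the value 1 at t.
  · obtain ⟨n, hn⟩ := exists_nat_ge (2 / (t - r))
    have hr : 0 < t - r := by simp only [r]; linarith
    refine ⟨n, hcfc (continuous_ramp r n) ht ?_⟩
    rw [ramp_eq_one ((div_le_iff₀ hr).mp hn)]
    exact one_ne_zero
  · have hr : 0 < r - s := by simp only [r]; linarith
    rw [max_eq_right hr.le]; exact hr.ne'
  · rw [← cfc_mul _ _ a (continuous_ramp r n).continuousOn hg.continuousOn, ← cfc_zero ℝ a]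
    refine cfc_congr fun x _ => ?_
    rcases le_total x r with hx | hx
    · simp [ramp_eq_zero n hx]
    · simp [max_eq_left (sub_nonpos.mpr hx)]
  · exact isPos_iff_nonneg.mpr (cfc_nonneg fun x _ => ramp_nonneg r n x)
  · exact isPos_iff_nonneg.mpr (sub_nonneg.mpr (cfc_mono (fun x _ => ramp_mono hij x)
      (continuous_ramp r i).continuousOn (continuous_ramp r j).continuousOn))

end Action

end FixedPoints

end QuantumAction

/-! ### The equivalence of the four properties -/

theorem mainTheorem3 {C A : Type u} [CStarAlgebra C] [CStarAlgebra A]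
    (G : QuantumAction.CompactQuantumGroup A) (δ : QuantumAction.Action G C)
    (hδ : δ.Nondegenerate) :
    List.TFAE [
      δ.Ergodic,
      ¬ ∃ I : Ideal C, IsClosed (I : Set C) ∧ I ≠ ⊥ ∧ I ≠ ⊤ ∧ δ.Invariant I ∧
        δ.spanImage I = QuantumAction.tensorWith (I : Set C) A,
      ¬ ∃ H : NonUnitalStarSubalgebra ℂ C, QuantumAction.IsHereditary H ∧ H ≠ ⊥ ∧ H ≠ ⊤ ∧
        δ.Invariant H ∧
        (QuantumAction.hereditaryHull (δ.hom '' H) : Set (QuantumAction.Spatial C A)) =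
          QuantumAction.tensorWith (H : Set C) A,
      ¬ ∃ p : QuantumAction.Bidual C, QuantumAction.IsOpenProj p ∧ p ≠ 0 ∧
        p ≠ QuantumAction.toBidual 1 ∧
        QuantumAction.bidualMap δ.hom p =
          QuantumAction.bidualMap (QuantumAction.spatialLeft C A) p] := by
  tfae_have 1 → 2 := fun he ⟨I, hI, hb, ht, hinv, hs⟩ => hb (he.ideal_eq_bot hI ht hinv hs)
  tfae_have 1 → 3 := fun he ⟨H, hH, hb, ht, hinv, hs⟩ => hb (he.hereditary_eq_bot hH ht hinv hs)
  tfae_have 1 → 4 := fun he ⟨p, hp, h0, h1, h⟩ =>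
    (he.proj_eq_zero_or_one hp.1 h).elim h0 h1
  tfae_have 2 → 1 := fun h => by
    by_contra hn
    obtain ⟨e, g, he, hf, ⟨n, hne⟩, hg, heg, -, -⟩ :=
      QuantumAction.Action.exists_supportUnit_of_not_ergodic hn
    exact h ⟨he.ideal, he.isClosed_ideal, fun hb => hne (by simpa [hb] using he.mem n),
      he.ideal_ne_top hg heg, QuantumAction.Action.invariant_ideal he hf,
      QuantumAction.Action.spanImage_ideal he hf hδ⟩
  tfae_have 3 → 1 := fun h => by
    by_contra hn
    obtain ⟨e, g, he, hf, ⟨n, hne⟩, hg, heg, -, -⟩ :=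
      QuantumAction.Action.exists_supportUnit_of_not_ergodic hn
    exact h ⟨he.hereditary, he.isHereditary,
      fun hb => hne (by
        have := he.mem_hereditary_self n
        rwa [hb, NonUnitalStarAlgebra.mem_bot] at this),
      he.hereditary_ne_top hg heg, QuantumAction.Action.invariant_hereditary he hf,
      QuantumAction.Action.hereditaryHull_hereditary he hf⟩
  tfae_have 4 → 1 := fun h => by
    by_contra hn
    obtain ⟨e, g, he, hf, ⟨n, hne⟩, hg, heg, hpos, hmono⟩ :=
      QuantumAction.Action.exists_supportUnit_of_not_ergodic hn
    obtain ⟨p, hp⟩ := QuantumAction.exists_bidual_limit_of_monotone hpos hmono he.norm_le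
    refine h ⟨p, he.isOpenProj_limit hp hpos hmono, he.limit_ne_zero hp hne,
      he.limit_ne_one hp hg heg, ContinuousLinearMap.ext fun φ => ?_⟩
    -- At φ the two sides are the limits of φ(δ(e_n)) and φ(e_n ⊗ 1), which agree term by term.
    refine tendsto_nhds_unique (hp (φ.comp (QuantumAction.homL δ.hom)))
      ((hp (φ.comp (QuantumAction.homL (QuantumAction.spatialLeft C A)))).congr fun n => ?_)
    exact congrArg φ (hf n).symm
  tfae_finish
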